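/- **Setting.** Consider a state-space model on measurable spaces $\mathsf X,\mathsf Y$ carrying $\sigma$-finite reference measures (e.g. subsets of $\mathbb R^{d_x},\mathbb R^{d_y}$ with Lebesgue measure), with initial density $\mu(x_1)$, transition density $f(x'|x)$ and observation density $g(y|x)$. Fix $T\ge 1$, observations $y_{1:T}$, and proposal densities $q_1(x_1)$, $q_t(x_t|x_{t-1})$ for $2\le t\le T$. The incremental weights are $$w_1(x_1)=\frac{g(y_1|x_1)\mu(x_1)}{q_1(x_1)},\qquad w_t(x_{t-1},x_t)=\frac{g(y_t|x_t)f(x_t|x_{t-1})}{q_t(x_t|x_{t-1})}\quad(2\le t\le T),$$ assumed to be everywhere strictly positive, and the likelihood $p(y_{1:T})=\int \mu(x_1)g(y_1|x_1)\prod_{t=2}^T f(x_t|x_{t-1})g(y_t|x_t)\,\mathrm dx_{1:T}$ is assumed finite. For every $N\ge1$ let $r_N(\cdot|W)$ be a resampling scheme: a probability distribution on $[N]^N$, $[N]=\{1,\dots,N\}$, for every probability vector $W$ on $[N]$. The particle filter (PF) with $N$ particles draws $X_1^i\sim q_1$ i.i.d.; for $t=2,\dots,T$ it draws ancestors $A_{t-1}^{1:N}\sim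 r_N(\cdot|W_{t-1}^{1:N})$ and then, independently over $i$, $X_t^i\sim q_t(\cdot|X_{t-1}^{A_{t-1}^i})$. Here $w_t^i$ denotes the incremental weight of particle $i$ at time $t$ (evaluated at $X_1^i$ for $t=1$, and at $(X_{t-1}^{A_{t-1}^i},X_t^i)$ for $t\ge2$) and $W_t^i=w_t^i/\sum_j w_t^j$. Its output is $(X_{1:T},p_N)$, where $p_N=\prod_{t=1}^T\frac1N\sum_{i=1}^N w_t^i$ and $X_{1:T}$ is the ancestral path of the terminal particle $j$, chosen with probability $W_T^j$. *Coupled PIMH.* Let $\xi_0,\xi_1,\xi_2,\dots$ be independent PF outputs, $\xi_n=(X^*_{1:T,n},p^*_n)$, and let $\mathfrak u_1,\mathfrak u_2,\dots$ be independent uniform variables on $[0,1]$, independent of the $\xi_n$. Write $a(p,p')=1\wedge(p'/p)$. The first chain starts at $U^{(0)}=\xi_0$, with likelihood estimate $p^{(0)}$. At iteration $n\ge1$, $U^{(n)}=\xi_n$ if $\mathfrak u_n\le a(p^{(n-1)},p_n^*)$ and $U^{(n)}=U^{(n-1)}$ otherwise, while the second chain sets $\tilde U^{(n-1)}=\xi_n$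 if $\mathfrak u_n\le a(\tilde p^{(n-2)},p_n^*)$ and $\tilde U^{(n-1)}=\tilde U^{(n-2)}$ otherwise, with the convention $a(\tilde p^{(-1)},\cdot)=1$; here $p^{(n)}$, $\tilde p^{(n)}$ are the likelihood estimates of $U^{(n)}$, $\tilde U^{(n)}$. The meeting time $\tau$ is the first $n\ge1$ at which both chains accept, i.e. $\mathfrak u_n\le a(p^{(n-1)},p^*_n)\wedge a(\tilde p^{(n-2)},p^*_n)$ ($\tau=\infty$ if there is none). Let $Z=\log\{p_N/p(y_{1:T})\}$, let $g_N(\mathrm dz)$ be its distribution under the PF, let $Z^{(0)}=\log\{p^{(0)}/p(y_{1:T})\}$, and let $\alpha(z)=\int\{1\wedge\exp(z'-z)\}\,g_N(\mathrm dz')$ be the average acceptance probability from $z$. **Proposition.** 1. For every $N\ge1$: $0<\alpha(z)\le1$ for all $z$, and the conditional distribution of $\tau$ given $Z^{(0)}$ is geometric on $\{1,2,\dots\}$ with success probability $\alpha(Z^{(0)})$, that is, almost surely $\mathbb P[\tau=k\mid Z^{(0)}]=\alpha(Z^{(0)})\{1-\alpha(Z^{(0)})\}^{k-1}$ for all $k\ge1$.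 2. For every $N\ge1$: $\mathbb P[\tau=1]\ge\frac12$. 3. Suppose that each $w_t$, $1\le t\le T$, is bounded; that the resampling schemes are unbiased, i.e. $\sum_{i=1}^N r_N(A^i=k|W)=NW^k$ for all $k$ and all probability vectors $W$; and that the resampling noise vanishes, i.e. for every $t<T$ and every bounded measurable $\varphi:\mathsf X\to\mathbb R$, $$\mathbb E\Big[\mathrm{Var}\Big(\tfrac1N\sum_{i=1}^N\varphi\big(X_t^{A_t^i}\big)\,\Big|\,X_t^{1:N},W_t^{1:N}\Big)\Big]\to0\qquad(N\to\infty)$$ (for multinomial resampling, for instance, the conditional variance is at most $\sup|\varphi|^2/N$). Then $\lim_{N\to\infty}\mathbb P[\tau=1]=1$. -/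

import Mathlib

open MeasureTheory ProbabilityTheory Filter Topology
open scoped ENNReal

noncomputable section

namespace CoupledPIMH

/-! ### State-space model, proposals and incremental weights -/

/-- `h` is a probability density with respect to `ν`. -/
def IsDensity {E : Type*} [MeasurableSpace E] (ν : Measure E) (h : E → ℝ) : Prop :=
  Measurable h ∧ (∀ x, 0 ≤ h x) ∧ ∫⁻ x, ENNReal.ofReal (h x) ∂ν = 1

/-- `h x ·` is a probability density with respect to `ν` for every `x`, measurably in both
variables: `h x x'` stands for `h(x' | x)`. -/
def IsTransitionDensity {D E : Type*} [MeasurableSpace D] [MeasurableSpace E] (ν : Measure E)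
    (h : D → E → ℝ) : Prop :=
  Measurable (Function.uncurry h) ∧ (∀ x x', 0 ≤ h x x') ∧
    ∀ x, ∫⁻ x', ENNReal.ofReal (h x x') ∂ν = 1

/-- A state-space model: initial density `μ(x)`, transition density `f(x' | x) = trans x x'`,
observation density `g(y | x) = obs x y`. -/
structure StateSpaceModel {X Y : Type*} [MeasurableSpace X] [MeasurableSpace Y]
    (νX : Measure X) (νY : Measure Y) where
  init : X → ℝ
  trans : X → X → ℝ
  obs : X → Y → ℝ
  isDensity_init : IsDensity νX init
  isTransitionDensity_trans : IsTransitionDensity νX trans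
  isTransitionDensity_obs : IsTransitionDensity νY obs

/-- Proposal densities of the particle filter. Times are numbered from `0` here:
`first` proposes the state at time `0`, and `next t x x'` is the density at `x'` of the
proposal for the state at time `t + 1` given the state `x` at time `t`. -/
structure Proposals {X : Type*} [MeasurableSpace X] (νX : Measure X) where
  first : X → ℝ
  next : ℕ → X → X → ℝ
  isDensity_first : IsDensity νX first
  isTransitionDensity_next : ∀ t, IsTransitionDensity νX (next t)

/-- A resampling scheme for `N` particles: for every weight vector `W` a probability mass
function `prob W` on ancestor vectors `[N]^N`. Only its values at probability vectors `W`
matter. -/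
structure ResamplingScheme (N : ℕ) where
  prob : (Fin N → ℝ) → (Fin N → Fin N) → ℝ
  measurable_prob : ∀ a, Measurable fun W => prob W a
  prob_nonneg : ∀ W a, 0 ≤ prob W a
  sum_prob : ∀ W, ∑ a, prob W a = 1

/-- `∑ i, r(A^i = k | W) = N W^k` for every probability vector `W` and every `k`. -/
def ResamplingScheme.IsUnbiased {N : ℕ} (R : ResamplingScheme N) : Prop :=
  ∀ W ∈ stdSimplex ℝ (Fin N), ∀ k : Fin N,
    ∑ i : Fin N, ∑ a : Fin N → Fin N, (if a i = k then R.prob W a else 0) = N * W k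

/-- The variance of `(1/N) ∑ i, φ (A^i)` when `A ∼ r(· | W)`. -/
def ResamplingScheme.variance {N : ℕ} (R : ResamplingScheme N) (W : Fin N → ℝ)
    (φ : Fin N → ℝ) : ℝ :=
  ∑ a, R.prob W a *
    ((1 / (N : ℝ)) * ∑ i, φ (a i) - ∑ a', R.prob W a' * ((1 / (N : ℝ)) * ∑ i, φ (a' i))) ^ 2

section Filter

variable {X Y : Type*} [MeasurableSpace X] [MeasurableSpace Y]
  {νX : Measure X} {νY : Measure Y}

/-- Incremental weight at the first time, `g(y | x) μ(x) / q(x)`. -/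
def weightFirst (M : StateSpaceModel νX νY) (Q : Proposals νX) (y : ℕ → Y) (x : X) : ℝ :=
  M.obs x (y 0) * M.init x / Q.first x

/-- Incremental weight of a move from `x` at time `t` to `x'` at time `t + 1`,
`g(y | x') f(x' | x) / q(x' | x)`. -/
def weightNext (M : StateSpaceModel νX νY) (Q : Proposals νX) (y : ℕ → Y) (t : ℕ)
    (x x' : X) : ℝ :=
  M.obs x' (y (t + 1)) * M.trans x x' / Q.next t x x'

/-- The joint density of the states at times `0, …, n` and of the observations `y`. -/
def jointDensity (M : StateSpaceModel νX νY) (y : ℕ → Y) (n : ℕ) (x : Fin (n + 1) → X) : ℝ :=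
  M.init (x 0) * M.obs (x 0) (y 0) *
    ∏ k : Fin n, M.trans (x k.castSucc) (x k.succ) * M.obs (x k.succ) (y (k + 1))

/-- The likelihood of the observations at times `0, …, n`. -/
def likelihood (M : StateSpaceModel νX νY) (y : ℕ → Y) (n : ℕ) : ℝ :=
  ∫ x, jointDensity M y n x ∂(Measure.pi fun _ : Fin (n + 1) => νX)

/-! ### The particle filter -/

/-- All particles `ζ.1 t i` (times `0, …, n`) and ancestor indices `ζ.2 t i` (the index at
time `t` of the parent of particle `i` of time `t + 1`) of one run of the filter. -/
abbrev ParticleSystem (X : Type*) (n N : ℕ) : Type _ :=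
  (Fin (n + 1) → Fin N → X) × (Fin n → Fin N → Fin N)

variable {n N : ℕ}

/-- Unnormalised weight of particle `i` at time `t`. -/
def particleWeight (M : StateSpaceModel νX νY) (Q : Proposals νX) (y : ℕ → Y)
    (ζ : ParticleSystem X n N) (t : Fin (n + 1)) (i : Fin N) : ℝ :=
  Fin.cases (weightFirst M Q y (ζ.1 0 i))
    (fun k : Fin n => weightNext M Q y k (ζ.1 k.castSucc (ζ.2 k i)) (ζ.1 k.succ i)) t

/-- Normalised weight `W_t^i`. -/
def normWeight (M : StateSpaceModel νX νY) (Q : Proposals νX) (y : ℕ → Y)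
    (ζ : ParticleSystem X n N) (t : Fin (n + 1)) (i : Fin N) : ℝ :=
  particleWeight M Q y ζ t i / ∑ j, particleWeight M Q y ζ t j

/-- The likelihood estimator `p_N`. -/
def likelihoodEstimate (M : StateSpaceModel νX νY) (Q : Proposals νX) (y : ℕ → Y)
    (ζ : ParticleSystem X n N) : ℝ :=
  ∏ t : Fin (n + 1), ((1 / (N : ℝ)) * ∑ i, particleWeight M Q y ζ t i)

/-- Index at each time of the ancestor of the terminal particle `j`:
`b_n = j` and `b_t = a_t^{b_{t+1}}`. -/
def lineage (a : Fin n → Fin N → Fin N) (j : Fin N) (t : Fin (n + 1)) : Fin N :=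
  Fin.reverseInduction (motive := fun _ => Fin N) j (fun k b => a k b) t

/-- The path of the terminal particle `j`. -/
def trajectory (ζ : ParticleSystem X n N) (j : Fin N) (t : Fin (n + 1)) : X :=
  ζ.1 t (lineage ζ.2 j t)

/-- Density of the particle system generated by the filter: at the first time the particles
are i.i.d. from the first proposal; then at each step the ancestors are drawn by the resampling
scheme given the normalised weights, and the particles are moved independently from their
ancestors by the proposal. -/
def filterDensity (M : StateSpaceModel νX νY) (Q : Proposals νX) (y : ℕ → Y)
    (R : ResamplingScheme N) (ζ : ParticleSystem X n N) : ℝ :=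
  (∏ i, Q.first (ζ.1 0 i)) *
    ∏ k : Fin n, (R.prob (normWeight M Q y ζ k.castSucc) (ζ.2 k) *
      ∏ i, Q.next k (ζ.1 k.castSucc (ζ.2 k i)) (ζ.1 k.succ i))

/-- Reference measure on particle systems: `νX` for each particle, counting measure for the
ancestor indices. -/
def systemMeasure (νX : Measure X) (n N : ℕ) : Measure (ParticleSystem X n N) :=
  (Measure.pi fun _ : Fin (n + 1) => Measure.pi fun _ : Fin N => νX).prod Measure.count

/-- Law of the particle system. -/
def systemLaw (M : StateSpaceModel νX νY) (Q : Proposals νX) (y : ℕ → Y) (n : ℕ)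
    (R : ResamplingScheme N) : Measure (ParticleSystem X n N) :=
  (systemMeasure νX n N).withDensity fun ζ => ENNReal.ofReal (filterDensity M Q y R ζ)

/-- Joint law of a terminal index `j`, drawn with probability equal to its normalised weight
at the last time, and of the particle system. -/
def indexedSystemLaw (M : StateSpaceModel νX νY) (Q : Proposals νX) (y : ℕ → Y) (n : ℕ)
    (R : ResamplingScheme N) : Measure (Fin N × ParticleSystem X n N) :=
  (Measure.count.prod (systemMeasure νX n N)).withDensity fun s =>
    ENNReal.ofReal (filterDensity M Q y R s.2 * normWeight M Q y s.2 (Fin.last n) s.1)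

/-- Law of the output (selected path, likelihood estimate) of the particle filter. -/
def filterLaw (M : StateSpaceModel νX νY) (Q : Proposals νX) (y : ℕ → Y) (n : ℕ)
    (R : ResamplingScheme N) : Measure ((Fin (n + 1) → X) × ℝ) :=
  (indexedSystemLaw M Q y n R).map fun s => (trajectory s.2 s.1, likelihoodEstimate M Q y s.2)

/-- The error `log (p_N / p)` of the log-likelihood estimator at a filter output. -/
def logError (M : StateSpaceModel νX νY) (y : ℕ → Y) (n : ℕ) (s : (Fin (n + 1) → X) × ℝ) : ℝ :=
  Real.log (s.2 / likelihood M y n)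

/-- The distribution `g(dz)` of the log-likelihood error under the law of the filter. -/
def errorLaw (M : StateSpaceModel νX νY) (Q : Proposals νX) (y : ℕ → Y) (n : ℕ)
    (R : ResamplingScheme N) : Measure ℝ :=
  (filterLaw M Q y n R).map (logError M y n)

/-- The average acceptance probability `α(z) = ∫ min(1, exp(z' - z)) g(dz')`. -/
def avgAcceptance (M : StateSpaceModel νX νY) (Q : Proposals νX) (y : ℕ → Y) (n : ℕ)
    (R : ResamplingScheme N) (z : ℝ) : ℝ :=
  ∫ z', min 1 (Real.exp (z' - z)) ∂(errorLaw M Q y n R)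

/-- The resampling noise of the schemes `R N` vanishes along the particle filter: at each
resampling time `t < n` and for each bounded measurable `φ`, the conditional variance of
`(1/N) ∑ i, φ (X_t^{A_t^i})` given the particles and weights of time `t` has an expectation
that tends to `0` as `N → ∞`. -/
def VanishingResamplingNoise (M : StateSpaceModel νX νY) (Q : Proposals νX) (y : ℕ → Y) (n : ℕ)
    (R : ∀ N, ResamplingScheme N) : Prop :=
  ∀ (k : Fin n) (φ : X → ℝ), Measurable φ → (∃ C, ∀ x, |φ x| ≤ C) →
    Tendsto (fun N => ∫ ζ, (R N).variance (normWeight M Q y ζ k.castSucc)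
      (fun i => φ (ζ.1 k.castSucc i)) ∂(systemLaw M Q y n (R N))) atTop (𝓝 0)

end Filter

/-! ### Coupled particle independent Metropolis-Hastings -/

section Coupling

variable {E : Type*}

/-- Acceptance probability of a proposal with estimate `p'` from a state with estimate `p`. -/
def acceptProb (p p' : ℝ) : ℝ := min 1 (p' / p)

/-- The first chain `U^(n)`: it starts at `ξ 0`, and `ξ n`, `u n` are the proposal and the
uniform variable of iteration `n ≥ 1`. The second component of a state is its likelihood
estimate. -/
def firstChain (ξ : ℕ → E × ℝ) (u : ℕ → ℝ) : ℕ → E × ℝ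
  | 0 => ξ 0
  | n + 1 =>
    if u (n + 1) ≤ acceptProb (firstChain ξ u n).2 (ξ (n + 1)).2 then ξ (n + 1)
    else firstChain ξ u n

/-- The second chain: `secondChain ξ u n` is its state with number `n`, produced at iteration
`n + 1` with the same proposal and the same uniform variable as in the first chain. The
proposal of iteration `1` is always accepted. -/
def secondChain (ξ : ℕ → E × ℝ) (u : ℕ → ℝ) : ℕ → E × ℝ
  | 0 => ξ 1
  | n + 1 =>
    if u (n + 2) ≤ acceptProb (secondChain ξ u n).2 (ξ (n + 2)).2 then ξ (n + 2)
    else secondChain ξ u n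

/-- Acceptance probability of the second chain at iteration `n ≥ 1`
(with the convention that it is `1` at the first iteration). -/
def secondAcceptProb (ξ : ℕ → E × ℝ) (u : ℕ → ℝ) (n : ℕ) : ℝ :=
  if n ≤ 1 then 1 else acceptProb (secondChain ξ u (n - 2)).2 (ξ n).2

/-- The meeting time: the first iteration `n ≥ 1` at which both chains accept the proposal
(`⊤` if there is none). -/
def meetingTime (ξ : ℕ → E × ℝ) (u : ℕ → ℝ) : ℕ∞ :=
  sInf ((fun n : ℕ => (n : ℕ∞)) '' {n : ℕ | 1 ≤ n ∧
    u n ≤ min (acceptProb (firstChain ξ u (n - 1)).2 (ξ n).2) (secondAcceptProb ξ u n)})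

/-- The random input of the coupled algorithm: independent filter outputs `ξ n` with law `L`
and independent uniform variables `u n` on `[0, 1]`. -/
structure IsRandomInput [MeasurableSpace E] (L : Measure (E × ℝ)) {Ω : Type*}
    [MeasurableSpace Ω] (P : Measure Ω) (ξ : ℕ → Ω → E × ℝ) (u : ℕ → Ω → ℝ) : Prop where
  measurable_proposal : ∀ n, Measurable (ξ n)
  measurable_uniform : ∀ n, Measurable (u n)
  map_proposal : ∀ n, P.map (ξ n) = L
  map_uniform : ∀ n, P.map (u n) = volume.restrict (Set.Icc (0 : ℝ) 1)
  indep_proposal_uniform : ∀ n, IndepFun (ξ n) (u n) P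
  indep_iterations : iIndepFun (fun n ω => (ξ n ω, u n ω)) P

end Coupling

/-- The geometric distribution on the positive integers with success probability `γ`, as a
measure on `ℕ∞`. -/
def geometricLaw (γ : ℝ) : Measure ℕ∞ :=
  Measure.sum fun k : ℕ =>
    ENNReal.ofReal ((1 - γ) ^ k * γ) • Measure.dirac ((k + 1 : ℕ) : ℕ∞)

end CoupledPIMH

end

/-!
The three claims rest on two facts, one about the coupling and one about the particle filter.

*Coupling.* Until the meeting the first chain stays at its initial state `ξ 0`, and the estimate of
the second chain never exceeds that of `ξ 0`: a proposal that the first chain rejects has a smaller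
estimate, and since the acceptance probability decreases in the current estimate, a proposal
accepted by the first chain is accepted by the second one too. So the meeting time is the first
success of the trials `u (k + 1) ≤ min 1 (p' / p₀)` (`meetingTime_eq_firstSuccess_acceptProb`),
where `p₀` is the initial estimate and `p'` that of proposal `k + 1`. Given the initial state these
trials are independent and succeed with probability `α(Z₀)`, which gives the geometric law
(`IsRandomInput.map_firstSuccess`, `IsRandomInput.condDistrib_firstSuccess`). The first of them
succeeds whenever `p₀ ≤ p'`, an event of probability at least `1 / 2` by exchangeability
(`IsRandomInput.half_le_measure_accept`).

*Filter.* If the likelihood estimator is consistent, then `p' / p₀` tends to `1` in probability and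
the first proposal is accepted with a probability that tends to `1` (`tendsto_measure_accept`).
Consistency is a mean square statement proved by induction on time for the estimates of all
unnormalised filtering integrals of bounded functions (`tendsto_meanSquareError`). Conditioning on
the past (`lintegral_systemLaw_succ`), the error at time `t + 1` for `φ` splits into the variance of
the moves, of order `1 / N`; the variance of the resampling, which vanishes by assumption; and, as
the resampling is unbiased, the error at time `t` for the function predicted from `φ`
(`meanSquareError_succ_le`). The limit for `φ = 1` is the likelihood, by Fubini's theorem
(`filterIntegral_one`).
-/

namespace CoupledPIMH

/-! ### Reduction of the meeting time to a first success -/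

/-- The first success time `k + 1` of a sequence of trials `C 0, C 1, …` (`⊤` if all fail):
the trial `C k` is the one of iteration `k + 1`. -/
noncomputable def firstSuccess (C : ℕ → Prop) : ℕ∞ :=
  sInf ((fun k : ℕ => ((k + 1 : ℕ) : ℕ∞)) '' {k | C k})

lemma firstSuccess_eq_of_isLeast {C : ℕ → Prop} {k : ℕ} (hk : C k) (h : ∀ j < k, ¬ C j) :
    firstSuccess C = ((k + 1 : ℕ) : ℕ∞) := by
  refine IsLeast.csInf_eq ⟨⟨k, hk, rfl⟩, ?_⟩
  rintro _ ⟨j, hj, rfl⟩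
  have : k ≤ j := not_lt.1 fun hlt => h j hlt hj
  exact Nat.cast_le.2 (Nat.succ_le_succ this)

lemma firstSuccess_eq_top {C : ℕ → Prop} (h : ∀ k, ¬ C k) : firstSuccess C = ⊤ := by
  simp [firstSuccess, h]

lemma firstSuccess_eq_succ_iff {C : ℕ → Prop} {k : ℕ} :
    firstSuccess C = ((k + 1 : ℕ) : ℕ∞) ↔ C k ∧ ∀ j < k, ¬ C j := by
  classical
  refine ⟨fun h => ?_, fun h => firstSuccess_eq_of_isLeast h.1 h.2⟩
  by_cases hC : ∃ j, C j
  · have h' := firstSuccess_eq_of_isLeast (Nat.find_spec hC) (fun j hj => Nat.find_min hC hj)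
    rw [h] at h'
    have hk : k = Nat.find hC := by
      have := Nat.cast_injective (R := ℕ∞) h'
      omega
    rw [hk]
    exact ⟨Nat.find_spec hC, fun j hj => Nat.find_min hC hj⟩
  · rw [firstSuccess_eq_top (not_exists.1 hC)] at h
    exact absurd h.symm (ENat.natCast_ne_top _)

lemma firstSuccess_ne_zero (C : ℕ → Prop) : firstSuccess C ≠ 0 := by
  classical
  by_cases hC : ∃ j, C j
  · rw [firstSuccess_eq_of_isLeast (Nat.find_spec hC) (fun j hj => Nat.find_min hC hj)]
    simp
  · rw [firstSuccess_eq_top (not_exists.1 hC)]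
    simp

lemma firstSuccess_eq_top_iff {C : ℕ → Prop} : firstSuccess C = ⊤ ↔ ∀ k, ¬ C k := by
  classical
  refine ⟨fun h => ?_, firstSuccess_eq_top⟩
  by_contra! hC
  rw [firstSuccess_eq_of_isLeast (Nat.find_spec hC) (fun j hj => Nat.find_min hC hj)] at h
  exact ENat.natCast_ne_top _ h

/-- Two sequences of trials that agree as long as the first one has not succeeded have the same
first success time. -/
lemma firstSuccess_congr {C D : ℕ → Prop}
    (h : ∀ k, (∀ j < k, ¬ C j) → (C k ↔ D k)) : firstSuccess C = firstSuccess D := by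
  classical
  by_cases hC : ∃ j, C j
  · have hmin : ∀ j < Nat.find hC, ¬ C j := fun j hj => Nat.find_min hC hj
    rw [firstSuccess_eq_of_isLeast (Nat.find_spec hC) hmin]
    refine (firstSuccess_eq_of_isLeast ((h _ hmin).1 (Nat.find_spec hC)) fun j hj => ?_).symm
    rw [← h j fun i hi => hmin i (hi.trans hj)]
    exact hmin j hj
  · push Not at hC
    rw [firstSuccess_eq_top hC, firstSuccess_eq_top]
    intro k
    rw [← h k fun j _ => hC j]
    exact hC k

lemma measurable_firstSuccess {Ω : Type*} [MeasurableSpace Ω] {C : ℕ → Ω → Prop}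
    (hC : ∀ k, MeasurableSet {ω | C k ω}) :
    Measurable fun ω => firstSuccess fun k => C k ω := by
  rw [ENat.measurable_iff]
  rintro (_ | k)
  · convert MeasurableSet.empty (α := Ω)
    ext ω
    simpa using firstSuccess_ne_zero _
  · have : (fun ω => firstSuccess fun k => C k ω) ⁻¹' {((k + 1 : ℕ) : ℕ∞)}
        = {ω | C k ω} ∩ ⋂ j, ⋂ _ : j < k, {ω | C j ω}ᶜ := by
      ext ω
      simp only [Set.mem_preimage, Set.mem_singleton_iff, Set.mem_inter_iff, Set.mem_iInter]
      exact firstSuccess_eq_succ_iff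
    rw [this]
    exact (hC k).inter (MeasurableSet.iInter fun j => MeasurableSet.iInter fun _ => (hC j).compl)

section Deterministic

variable {E : Type*} (ξ : ℕ → E × ℝ) (u : ℕ → ℝ)

lemma acceptProb_le_one (p p' : ℝ) : acceptProb p p' ≤ 1 := min_le_left _ _

lemma acceptProb_anti {p q r : ℝ} (hp : 0 < p) (hr : 0 ≤ r) (h : p ≤ q) :
    acceptProb q r ≤ acceptProb p r :=
  min_le_min_left _ (div_le_div_of_nonneg_left hr hp h)

lemma secondAcceptProb_one : secondAcceptProb ξ u 1 = 1 := by simp [secondAcceptProb]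

lemma secondAcceptProb_add_two (k : ℕ) :
    secondAcceptProb ξ u (k + 2) = acceptProb (secondChain ξ u k).2 (ξ (k + 2)).2 := by
  simp [secondAcceptProb]

lemma meetingTime_eq_firstSuccess :
    meetingTime ξ u = firstSuccess fun k => u (k + 1) ≤
      min (acceptProb (firstChain ξ u k).2 (ξ (k + 1)).2) (secondAcceptProb ξ u (k + 1)) := by
  unfold meetingTime firstSuccess
  congr 1
  ext m
  constructor
  · rintro ⟨n, ⟨hn, h⟩, rfl⟩
    obtain ⟨k, rfl⟩ : ∃ k, n = k + 1 := ⟨n - 1, by omega⟩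
    exact ⟨k, by simpa using h, rfl⟩
  · rintro ⟨k, h, rfl⟩
    exact ⟨k + 1, ⟨by omega, by simpa using h⟩, rfl⟩

/-- Before the meeting the first chain does not move, and the estimate of the second chain stays
below that of the first one: whenever the first chain accepts, so does the second. -/
lemma chains_before_meeting (hp : ∀ n, 0 < (ξ n).2) (hu : ∀ n, u n ≤ 1) (k : ℕ)
    (h : ∀ j < k, ¬ u (j + 1) ≤
      min (acceptProb (firstChain ξ u j).2 (ξ (j + 1)).2) (secondAcceptProb ξ u (j + 1))) :
    firstChain ξ u k = ξ 0 ∧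
      acceptProb (ξ 0).2 (ξ (k + 1)).2 ≤ secondAcceptProb ξ u (k + 1) ∧
      ∀ m, k = m + 1 → 0 < (secondChain ξ u m).2 ∧ (secondChain ξ u m).2 ≤ (ξ 0).2 := by
  -- A proposal rejected by a chain with estimate `p` has an estimate below `p`, as `u ≤ 1`.
  have hrej : ∀ n, ¬ u n ≤ acceptProb (ξ 0).2 (ξ n).2 → (ξ n).2 ≤ (ξ 0).2 := by
    intro n hn
    by_contra! hlt
    refine hn ((hu n).trans (le_min le_rfl ?_))
    rw [one_le_div (hp 0)]
    exact hlt.le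
  induction k with
  | zero =>
    refine ⟨rfl, ?_, fun m hm => by omega⟩
    rw [zero_add, secondAcceptProb_one]
    exact acceptProb_le_one _ _
  | succ k ih =>
    obtain ⟨h1, h2, h3⟩ := ih fun j hj => h j (hj.trans (Nat.lt_succ_self k))
    have hk := h k (Nat.lt_succ_self k)
    rw [h1] at hk
    have hk' : ¬ u (k + 1) ≤ acceptProb (ξ 0).2 (ξ (k + 1)).2 := fun hle =>
      hk (le_min hle (hle.trans h2))
    have hsecond : 0 < (secondChain ξ u k).2 ∧ (secondChain ξ u k).2 ≤ (ξ 0).2 := by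
      cases k with
      | zero => exact ⟨hp 1, hrej 1 hk'⟩
      | succ m =>
        rw [secondChain]
        split_ifs
        · exact ⟨hp _, hrej _ hk'⟩
        · exact h3 m rfl
    refine ⟨?_, ?_, fun m hm => ?_⟩
    · rw [firstChain, h1, if_neg hk']
    · rw [secondAcceptProb_add_two]
      exact acceptProb_anti hsecond.1 (hp _).le hsecond.2
    · obtain rfl : k = m := by omega
      exact hsecond

/-- The meeting time is the first time at which a proposal is accepted from the initial state of
the first chain, as this chain stays there until the meeting. -/
lemma meetingTime_eq_firstSuccess_acceptProb (hp : ∀ n, 0 < (ξ n).2) (hu : ∀ n, u n ≤ 1) :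
    meetingTime ξ u = firstSuccess fun k => u (k + 1) ≤ acceptProb (ξ 0).2 (ξ (k + 1)).2 := by
  rw [meetingTime_eq_firstSuccess]
  refine firstSuccess_congr fun k hk => ?_
  obtain ⟨h1, h2, -⟩ := chains_before_meeting ξ u hp hu k hk
  rw [h1, min_eq_left h2]

lemma meetingTime_eq_one_iff :
    meetingTime ξ u = 1 ↔ u 1 ≤ acceptProb (ξ 0).2 (ξ 1).2 := by
  rw [meetingTime_eq_firstSuccess]
  have := @firstSuccess_eq_succ_iff (fun k => u (k + 1) ≤
      min (acceptProb (firstChain ξ u k).2 (ξ (k + 1)).2) (secondAcceptProb ξ u (k + 1))) 0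
  simp only [zero_add, Nat.cast_one] at this
  rw [this, secondAcceptProb_one, min_eq_left (acceptProb_le_one _ _)]
  simp [firstChain]

end Deterministic

/-! ### The law of the meeting time -/

section Law

variable {E : Type*} [MeasurableSpace E] {L : Measure (E × ℝ)} {Ω : Type*} [MeasurableSpace Ω]
  {P : Measure Ω} [IsProbabilityMeasure P] {ξ : ℕ → Ω → E × ℝ} {u : ℕ → Ω → ℝ}

/-- The trial with proposal and uniform variable `v` from a state with error `z` succeeds, the
error of a state being `ℓ`. -/
def Accepts (ℓ : E × ℝ → ℝ) (z : ℝ) (v : (E × ℝ) × ℝ) : Prop :=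
  v.2 ≤ min 1 (Real.exp (ℓ v.1 - z))

lemma measurableSet_accepts {ℓ : E × ℝ → ℝ} (hℓ : Measurable ℓ) :
    MeasurableSet {s : ℝ × ((E × ℝ) × ℝ) | Accepts ℓ s.1 s.2} := by
  unfold Accepts
  exact measurableSet_le (by fun_prop) (by fun_prop)

omit [IsProbabilityMeasure P] in
lemma IsRandomInput.measurable_pair (h : IsRandomInput L P ξ u) (n : ℕ) :
    Measurable fun ω => (ξ n ω, u n ω) :=
  (h.measurable_proposal n).prodMk (h.measurable_uniform n)

lemma IsRandomInput.isProbabilityMeasure (h : IsRandomInput L P ξ u) :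
    IsProbabilityMeasure L := by
  rw [← h.map_proposal 0]
  exact Measure.isProbabilityMeasure_map (h.measurable_proposal 0).aemeasurable

omit [IsProbabilityMeasure P] in
lemma IsRandomInput.ae_le_one (h : IsRandomInput L P ξ u) : ∀ᵐ ω ∂P, ∀ n, u n ω ≤ 1 := by
  rw [ae_all_iff]
  intro n
  have : ∀ᵐ x ∂(P.map (u n)), x ≤ 1 := by
    rw [h.map_uniform n]
    filter_upwards [ae_restrict_mem measurableSet_Icc] with x hx using hx.2
  exact ae_of_ae_map (h.measurable_uniform n).aemeasurable this

omit [IsProbabilityMeasure P] in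
lemma IsRandomInput.ae_proposal (h : IsRandomInput L P ξ u) {p : E × ℝ → Prop}
    (hp : ∀ᵐ s ∂L, p s) : ∀ᵐ ω ∂P, ∀ n, p (ξ n ω) := by
  rw [ae_all_iff]
  intro n
  rw [← h.map_proposal n] at hp
  exact ae_of_ae_map (h.measurable_proposal n).aemeasurable hp

omit [IsProbabilityMeasure P] in
lemma IsRandomInput.indepFun_zero_tail (h : IsRandomInput L P ξ u) :
    IndepFun (ξ 0) (fun ω k => (ξ (k + 1) ω, u (k + 1) ω)) P := by
  have hdisj : Disjoint ({0} : Set ℕ) {n | 1 ≤ n} := by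
    rw [Set.disjoint_singleton_left]
    simp
  have key := indep_iSup_of_disjoint
    (m := fun n => MeasurableSpace.comap (fun ω => (ξ n ω, u n ω)) inferInstance)
    (fun n => (h.measurable_pair n).comap_le) h.indep_iterations hdisj
  refine indep_of_indep_of_le_left (indep_of_indep_of_le_right key ?_) ?_
  · simp only [MeasurableSpace.pi, MeasurableSpace.comap_iSup, MeasurableSpace.comap_comp]
    refine iSup_le fun k => ?_
    exact le_iSup₂_of_le (k + 1) (by simp) le_rfl
  · refine le_iSup₂_of_le 0 rfl ?_
    have : ξ 0 = Prod.fst ∘ fun ω => (ξ 0 ω, u 0 ω) := rfl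
    rw [this, ← MeasurableSpace.comap_comp]
    exact MeasurableSpace.comap_mono measurable_fst.comap_le

/-- From a state with error `z`, a trial succeeds with the average acceptance probability. -/
lemma IsRandomInput.measure_accepts (h : IsRandomInput L P ξ u) {ℓ : E × ℝ → ℝ}
    (hℓ : Measurable ℓ) (z : ℝ) (n : ℕ) :
    P ((fun ω => (ξ n ω, u n ω)) ⁻¹' {v | Accepts ℓ z v}) =
      ENNReal.ofReal (∫ z', min 1 (Real.exp (z' - z)) ∂(L.map ℓ)) := by
  have := h.isProbabilityMeasure
  have hS : MeasurableSet {v : (E × ℝ) × ℝ | Accepts ℓ z v} :=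
    measurable_prodMk_left (measurableSet_accepts hℓ)
  rw [← Measure.map_apply (h.measurable_pair n) hS,
    (h.indep_proposal_uniform n).map_prod_eq_prod_map_map
      (h.measurable_proposal n).aemeasurable (h.measurable_uniform n).aemeasurable,
    h.map_proposal n, h.map_uniform n, Measure.prod_apply hS,
    integral_map hℓ.aemeasurable (by fun_prop), ofReal_integral_eq_lintegral_ofReal]
  · refine lintegral_congr fun s => ?_
    have h0 : 0 ≤ min 1 (Real.exp (ℓ s - z)) := le_min zero_le_one (Real.exp_pos _).le
    have : Prod.mk s ⁻¹' {v : (E × ℝ) × ℝ | Accepts ℓ z v} = Set.Iic (min 1 (Real.exp (ℓ s - z))) :=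
      rfl
    have hIcc : Set.Iic (min 1 (Real.exp (ℓ s - z))) ∩ Set.Icc 0 1 =
        Set.Icc 0 (min 1 (Real.exp (ℓ s - z))) := by
      ext x
      simp only [Set.mem_inter_iff, Set.mem_Iic, Set.mem_Icc]
      exact ⟨fun hx => ⟨hx.2.1, hx.1⟩, fun hx => ⟨hx.2, hx.1, hx.2.trans (min_le_left _ _)⟩⟩
    rw [this, Measure.restrict_apply measurableSet_Iic, hIcc, Real.volume_Icc, sub_zero]
  · refine Integrable.of_bound (C := 1) (by fun_prop) (ae_of_all _ fun s => ?_)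
    rw [Real.norm_of_nonneg (le_min zero_le_one (Real.exp_pos _).le)]
    exact min_le_left _ _
  · exact ae_of_all _ fun s => le_min zero_le_one (Real.exp_pos _).le

lemma avg_min_one_exp_mem (ν : Measure ℝ) [IsProbabilityMeasure ν] (z : ℝ) :
    0 < ∫ z', min 1 (Real.exp (z' - z)) ∂ν ∧ ∫ z', min 1 (Real.exp (z' - z)) ∂ν ≤ 1 := by
  have hpos : ∀ z', 0 < min 1 (Real.exp (z' - z)) := fun z' =>
    lt_min zero_lt_one (Real.exp_pos _)
  have hint : Integrable (fun z' => min 1 (Real.exp (z' - z))) ν := by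
    refine Integrable.of_bound (C := 1) (by fun_prop) (ae_of_all _ fun s => ?_)
    rw [Real.norm_of_nonneg (hpos s).le]
    exact min_le_left _ _
  constructor
  · rw [integral_pos_iff_support_of_nonneg (fun z' => (hpos z').le) hint]
    have : Function.support (fun z' => min 1 (Real.exp (z' - z))) = Set.univ :=
      Set.eq_univ_of_forall fun z' => (hpos z').ne'
    rw [this]
    simp
  · calc ∫ z', min 1 (Real.exp (z' - z)) ∂ν ≤ ∫ _, (1 : ℝ) ∂ν :=
        integral_mono hint (integrable_const _) fun z' => min_le_left _ _
      _ = 1 := by simp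

lemma measurable_avg_min_one_exp (ν : Measure ℝ) [IsProbabilityMeasure ν] :
    Measurable fun z => ∫ z', min 1 (Real.exp (z' - z)) ∂ν := by
  have : StronglyMeasurable (Function.uncurry fun z z' : ℝ => min 1 (Real.exp (z' - z))) :=
    Measurable.stronglyMeasurable (by fun_prop)
  exact this.integral_prod_right.measurable

lemma geometricLaw_apply (γ : ℝ) (s : Set ℕ∞) :
    geometricLaw γ s = ∑' k : ℕ, ENNReal.ofReal ((1 - γ) ^ k * γ) *
      s.indicator 1 ((k + 1 : ℕ) : ℕ∞) := by
  simp [geometricLaw, Measure.sum_apply]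

lemma geometricLaw_singleton (γ : ℝ) (k : ℕ) :
    geometricLaw γ {((k + 1 : ℕ) : ℕ∞)} = ENNReal.ofReal ((1 - γ) ^ k * γ) := by
  rw [geometricLaw_apply, tsum_eq_single k]
  · simp
  · intro j hj
    have : ((j + 1 : ℕ) : ℕ∞) ∉ ({((k + 1 : ℕ) : ℕ∞)} : Set ℕ∞) := by
      rw [Set.mem_singleton_iff, Nat.cast_inj]
      omega
    rw [Set.indicator_of_notMem this, mul_zero]

lemma geometricLaw_eq_zero (γ : ℝ) {m : ℕ∞} (hm : ∀ k : ℕ, m ≠ ((k + 1 : ℕ) : ℕ∞)) :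
    geometricLaw γ {m} = 0 := by
  rw [geometricLaw_apply, ENNReal.tsum_eq_zero]
  intro k
  rw [Set.indicator_of_notMem, mul_zero]
  exact fun h => hm k h.symm

/-- From a state with error `z`, independent trials give a geometric first success time. -/
lemma IsRandomInput.map_firstSuccess (h : IsRandomInput L P ξ u) {ℓ : E × ℝ → ℝ}
    (hℓ : Measurable ℓ) (z : ℝ) :
    P.map (fun ω => firstSuccess fun k => Accepts ℓ z (ξ (k + 1) ω, u (k + 1) ω)) =
      geometricLaw (∫ z', min 1 (Real.exp (z' - z)) ∂(L.map ℓ)) := by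
  have := h.isProbabilityMeasure
  have := Measure.isProbabilityMeasure_map (μ := L) hℓ.aemeasurable
  obtain ⟨hα0, hα1⟩ := avg_min_one_exp_mem (L.map ℓ) z
  set α := ∫ z', min 1 (Real.exp (z' - z)) ∂(L.map ℓ) with hα
  set A : Set ((E × ℝ) × ℝ) := {v | Accepts ℓ z v}
  have hA : MeasurableSet A := measurable_prodMk_left (measurableSet_accepts hℓ)
  have hPA : ∀ n, P ((fun ω => (ξ n ω, u n ω)) ⁻¹' A) = ENNReal.ofReal α :=
    fun n => h.measure_accepts hℓ z n
  have hPAc : ∀ n, P ((fun ω => (ξ n ω, u n ω)) ⁻¹' Aᶜ) = ENNReal.ofReal (1 - α) := by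
    intro n
    rw [Set.preimage_compl, prob_compl_eq_one_sub (h.measurable_pair n hA), hPA,
      ENNReal.ofReal_sub _ hα0.le, ENNReal.ofReal_one]
  have hmeas : Measurable fun ω =>
      firstSuccess fun k => Accepts ℓ z (ξ (k + 1) ω, u (k + 1) ω) :=
    measurable_firstSuccess fun k => h.measurable_pair (k + 1) hA
  have hfail : ∀ k : ℕ, P (⋂ j ∈ Finset.Icc 1 k, (fun ω => (ξ j ω, u j ω)) ⁻¹' Aᶜ) =
      ENNReal.ofReal (1 - α) ^ k := by
    intro k
    rw [h.indep_iterations.measure_inter_preimage_eq_mul (Finset.Icc 1 k)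
      (sets := fun _ => Aᶜ) fun _ _ => hA.compl, Finset.prod_congr rfl fun j _ => hPAc j]
    simp
  have hsingle : ∀ k : ℕ, P.map (fun ω =>
      firstSuccess fun k => Accepts ℓ z (ξ (k + 1) ω, u (k + 1) ω)) {((k + 1 : ℕ) : ℕ∞)} =
        ENNReal.ofReal ((1 - α) ^ k * α) := by
    intro k
    rw [Measure.map_apply hmeas (measurableSet_singleton _)]
    have hset : (fun ω => firstSuccess fun k => Accepts ℓ z (ξ (k + 1) ω, u (k + 1) ω)) ⁻¹'
        {((k + 1 : ℕ) : ℕ∞)} = ⋂ j ∈ Finset.Icc 1 (k + 1), (fun ω => (ξ j ω, u j ω)) ⁻¹'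
          (if j = k + 1 then A else Aᶜ) := by
      ext ω
      simp only [Set.mem_preimage, Set.mem_singleton_iff, Set.mem_iInter, Finset.mem_Icc]
      rw [firstSuccess_eq_succ_iff]
      constructor
      · rintro ⟨h1, h2⟩ j ⟨hj1, hj2⟩
        obtain ⟨i, rfl⟩ : ∃ i, j = i + 1 := ⟨j - 1, by omega⟩
        by_cases hi : i = k
        · subst hi
          rw [if_pos rfl]
          exact h1
        · rw [if_neg (by omega)]
          exact h2 i (by omega)
      · intro hall
        refine ⟨?_, fun j hj => ?_⟩
        · have := hall (k + 1) ⟨by omega, le_rfl⟩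
          rwa [if_pos rfl] at this
        have := hall (j + 1) ⟨by omega, by omega⟩
        rw [if_neg (by omega)] at this
        exact this
    rw [hset, h.indep_iterations.measure_inter_preimage_eq_mul (Finset.Icc 1 (k + 1))
      (sets := fun j => if j = k + 1 then A else Aᶜ)
      (fun j _ => by split_ifs; exacts [hA, hA.compl]),
      ← Finset.insert_Icc_right_eq_Icc_add_one (by omega), Finset.prod_insert (by simp)]
    rw [if_pos rfl, hPA, Finset.prod_congr rfl (g := fun _ => ENNReal.ofReal (1 - α))]
    · rw [Finset.prod_const, Nat.card_Icc, mul_comm, ENNReal.ofReal_mul (by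
        have : 0 ≤ 1 - α := by linarith
        positivity), ENNReal.ofReal_pow (by linarith)]
      simp
    · intro j hj
      rw [Finset.mem_Icc] at hj
      rw [if_neg (by omega), hPAc]
  refine Measure.ext_of_singleton fun m => ?_
  by_cases hm : ∃ k : ℕ, m = ((k + 1 : ℕ) : ℕ∞)
  · obtain ⟨k, rfl⟩ := hm
    rw [hsingle, geometricLaw_singleton]
  · push Not at hm
    rw [geometricLaw_eq_zero _ hm, Measure.map_apply hmeas (measurableSet_singleton _)]
    have hm' : m = 0 ∨ m = ⊤ := by
      induction m with
      | top => exact Or.inr rfl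
      | coe n =>
        cases n with
        | zero => exact Or.inl rfl
        | succ k => exact absurd rfl (hm k)
    rcases hm' with rfl | rfl
    · convert measure_empty (μ := P)
      ext ω
      simpa using firstSuccess_ne_zero _
    · -- All trials up to time `k` fail with probability `(1 - α) ^ k`, for every `k`.
      have hle : ∀ k : ℕ, P ((fun ω =>
          firstSuccess fun k => Accepts ℓ z (ξ (k + 1) ω, u (k + 1) ω)) ⁻¹' {⊤}) ≤
            ENNReal.ofReal (1 - α) ^ k := by
        intro k
        rw [← hfail k]
        refine measure_mono fun ω hω => ?_
        simp only [Set.mem_iInter, Finset.mem_Icc]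
        rintro j ⟨hj1, -⟩
        obtain ⟨i, rfl⟩ : ∃ i, j = i + 1 := ⟨j - 1, by omega⟩
        exact firstSuccess_eq_top_iff.1 hω i
      have hlim := ENNReal.tendsto_pow_atTop_nhds_zero_of_lt_one (r := ENNReal.ofReal (1 - α))
        (by rw [ENNReal.ofReal_lt_one]; linarith)
      exact le_antisymm (ge_of_tendsto' hlim hle) bot_le

/-- The joint law of the initial error and of the meeting time, disintegrated along the former. -/
lemma IsRandomInput.condDistrib_firstSuccess (h : IsRandomInput L P ξ u) {ℓ : E × ℝ → ℝ}
    (hℓ : Measurable ℓ) {τ : Ω → ℕ∞}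
    (hτ : τ =ᵐ[P] fun ω =>
      firstSuccess fun k => Accepts ℓ (ℓ (ξ 0 ω)) (ξ (k + 1) ω, u (k + 1) ω)) :
    ∀ᵐ z ∂(P.map fun ω => ℓ (ξ 0 ω)), condDistrib τ (fun ω => ℓ (ξ 0 ω)) P z =
      geometricLaw (∫ z', min 1 (Real.exp (z' - z)) ∂(L.map ℓ)) := by
  have := h.isProbabilityMeasure
  have := Measure.isProbabilityMeasure_map (μ := L) hℓ.aemeasurable
  set V : Ω → ℕ → (E × ℝ) × ℝ := fun ω k => (ξ (k + 1) ω, u (k + 1) ω)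
  set Z : Ω → ℝ := fun ω => ℓ (ξ 0 ω)
  set F : ℝ × (ℕ → (E × ℝ) × ℝ) → ℕ∞ := fun s => firstSuccess fun k => Accepts ℓ s.1 (s.2 k)
  have hV : Measurable V := measurable_pi_lambda _ fun k => h.measurable_pair (k + 1)
  have hZ : Measurable Z := hℓ.comp (h.measurable_proposal 0)
  have hF : Measurable F := by
    refine measurable_firstSuccess fun k => ?_
    have : Measurable fun s : ℝ × (ℕ → (E × ℝ) × ℝ) => (s.1, s.2 k) := by fun_prop
    exact this (measurableSet_accepts hℓ)
  have hFm : ∀ z, Measurable fun v => F (z, v) := fun z => hF.comp measurable_prodMk_left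
  have hFz : ∀ z, (P.map V).map (fun v => F (z, v)) =
      geometricLaw (∫ z', min 1 (Real.exp (z' - z)) ∂(L.map ℓ)) := by
    intro z
    rw [Measure.map_map (hFm z) hV]
    exact h.map_firstSuccess hℓ z
  have hgeo : Measurable fun z =>
      geometricLaw (∫ z', min 1 (Real.exp (z' - z)) ∂(L.map ℓ)) := by
    refine Measure.measurable_of_measurable_coe _ fun s _ => ?_
    simp only [geometricLaw_apply]
    have := measurable_avg_min_one_exp (L.map ℓ)
    exact Measurable.tsum fun k =>
      (ENNReal.measurable_ofReal.comp (by fun_prop)).mul_const _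
  let κ : Kernel ℝ ℕ∞ := ⟨_, hgeo⟩
  have hPV := Measure.isProbabilityMeasure_map (μ := P) hV.aemeasurable
  have : IsMarkovKernel κ := ⟨fun z => by
    change IsProbabilityMeasure (geometricLaw _)
    rw [← hFz z]
    exact Measure.isProbabilityMeasure_map (hFm z).aemeasurable⟩
  have hindep : P.map (fun ω => (Z ω, V ω)) = (P.map Z).prod (P.map V) :=
    (h.indepFun_zero_tail.comp hℓ measurable_id).map_prod_eq_prod_map_map
      hZ.aemeasurable hV.aemeasurable
  have hτ' : τ =ᵐ[P] fun ω => F (Z ω, V ω) := hτ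
  have hFZV : Measurable fun ω => F (Z ω, V ω) := hF.comp (hZ.prodMk hV)
  refine condDistrib_ae_eq_of_measure_eq_compProd (κ := κ) Z ⟨_, hFZV, hτ'⟩ ?_
  have hcongr : P.map (fun ω => (Z ω, τ ω)) = P.map (fun ω => (Z ω, F (Z ω, V ω))) :=
    Measure.map_congr (by filter_upwards [hτ'] with ω hω; rw [hω])
  rw [hcongr]
  ext S hS
  have hG : Measurable fun s : ℝ × (ℕ → (E × ℝ) × ℝ) => (s.1, F s) :=
    measurable_fst.prodMk hF
  have hcomp : (fun ω => (Z ω, F (Z ω, V ω))) = (fun s : ℝ × (ℕ → (E × ℝ) × ℝ) => (s.1, F s)) ∘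
    fun ω => (Z ω, V ω) := rfl
  rw [hcomp, ← Measure.map_map hG (hZ.prodMk hV), hindep, Measure.map_apply hG hS,
    Measure.prod_apply (hG hS), Measure.compProd_apply hS]
  -- For a fixed initial error `z`, the time is the first success of the trials started from `z`.
  refine lintegral_congr fun z => ?_
  change _ = geometricLaw _ _
  rw [← hFz z, Measure.map_apply (hFm z) (measurable_prodMk_left hS)]
  rfl

/-- By exchangeability, the first proposal has at least the estimate of the initial state with
probability at least one half, and it is then accepted. -/
lemma IsRandomInput.half_le_measure_accept (h : IsRandomInput L P ξ u)
    (hL : ∀ᵐ s ∂L, 0 < s.2) :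
    1 / 2 ≤ P {ω | u 1 ω ≤ acceptProb (ξ 0 ω).2 (ξ 1 ω).2} := by
  have := h.isProbabilityMeasure
  have hind : ∀ i j, i ≠ j → P.map (fun ω => (ξ i ω, ξ j ω)) = L.prod L := by
    intro i j hij
    have := ((h.indep_iterations.indepFun hij).comp measurable_fst measurable_fst)
    have hmap : L.prod L = (P.map (ξ i)).prod (P.map (ξ j)) := by
      rw [h.map_proposal i, h.map_proposal j]
    rw [hmap]
    exact this.map_prod_eq_prod_map_map (h.measurable_proposal i).aemeasurable
      (h.measurable_proposal j).aemeasurable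
  have hS : MeasurableSet {s : (E × ℝ) × (E × ℝ) | s.1.2 ≤ s.2.2} :=
    measurableSet_le (by fun_prop) (by fun_prop)
  have hle : ∀ i j, i ≠ j → P {ω | (ξ i ω).2 ≤ (ξ j ω).2} =
      (L.prod L) {s : (E × ℝ) × (E × ℝ) | s.1.2 ≤ s.2.2} := by
    intro i j hij
    rw [← hind i j hij, Measure.map_apply
      ((h.measurable_proposal i).prodMk (h.measurable_proposal j)) hS]
    rfl
  have hsum : 1 ≤ P {ω | (ξ 0 ω).2 ≤ (ξ 1 ω).2} + P {ω | (ξ 0 ω).2 ≤ (ξ 1 ω).2} := by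
    nth_rw 2 [hle 0 1 (by simp)]
    rw [← hle 1 0 (by simp), ← measure_univ (μ := P)]
    refine (measure_mono fun ω _ => ?_).trans (measure_union_le _ _)
    exact le_total (ξ 0 ω).2 (ξ 1 ω).2
  have hsub : P {ω | (ξ 0 ω).2 ≤ (ξ 1 ω).2} ≤
      P {ω | u 1 ω ≤ acceptProb (ξ 0 ω).2 (ξ 1 ω).2} := by
    refine measure_mono_ae ?_
    filter_upwards [h.ae_le_one, h.ae_proposal hL] with ω h1 h2 hω
    refine (h1 1).trans (le_min le_rfl ?_)
    rw [one_le_div (h2 0)]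
    exact hω
  refine le_trans ?_ hsub
  rw [ENNReal.div_le_iff (by simp) (by simp), mul_two]
  exact hsum

omit [IsProbabilityMeasure P] in
/-- If the estimates of two independent runs are within `δ / 2` of `c`, relatively, then a uniform
variable below `1 - δ` accepts the second one from the first one. -/
lemma IsRandomInput.measure_reject_le (h : IsRandomInput L P ξ u) {c δ : ℝ} (hc : 0 < c)
    (hδ : 0 < δ) (hδ1 : δ < 1) :
    P {ω | u 1 ω ≤ acceptProb (ξ 0 ω).2 (ξ 1 ω).2}ᶜ ≤
      ENNReal.ofReal δ + 2 * L {s | c * (δ / 2) ≤ |s.2 - c|} := by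
  have hS : MeasurableSet {s : E × ℝ | c * (δ / 2) ≤ |s.2 - c|} :=
    measurableSet_le (by fun_prop) (by fun_prop)
  have hfar : ∀ n, P (ξ n ⁻¹' {s | c * (δ / 2) ≤ |s.2 - c|}) =
      L {s | c * (δ / 2) ≤ |s.2 - c|} := fun n => by
    rw [← h.map_proposal n, Measure.map_apply (h.measurable_proposal n) hS]
  have hu : P (u 1 ⁻¹' Set.Ioi (1 - δ)) = ENNReal.ofReal δ := by
    rw [← Measure.map_apply (h.measurable_uniform 1) measurableSet_Ioi, h.map_uniform 1,
      Measure.restrict_apply measurableSet_Ioi, Set.inter_comm]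
    have : Set.Icc (0 : ℝ) 1 ∩ Set.Ioi (1 - δ) = Set.Ioc (1 - δ) 1 := by
      ext x
      simp only [Set.mem_inter_iff, Set.mem_Icc, Set.mem_Ioi, Set.mem_Ioc]
      constructor
      · exact fun hx => ⟨hx.2, hx.1.2⟩
      · exact fun hx => ⟨⟨by linarith, hx.2⟩, hx.1⟩
    rw [this, Real.volume_Ioc]
    congr 1
    ring
  have hsub : {ω | u 1 ω ≤ acceptProb (ξ 0 ω).2 (ξ 1 ω).2}ᶜ ⊆ u 1 ⁻¹' Set.Ioi (1 - δ) ∪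
      (ξ 0 ⁻¹' {s | c * (δ / 2) ≤ |s.2 - c|} ∪ ξ 1 ⁻¹' {s | c * (δ / 2) ≤ |s.2 - c|}) := by
    intro ω hω
    by_contra hcon
    simp only [Set.mem_union, Set.mem_preimage, Set.mem_Ioi, Set.mem_ofPred_eq, not_or, not_lt,
      not_le] at hcon
    obtain ⟨h1, h2, h3⟩ := hcon
    rw [abs_lt] at h2 h3
    have hp0 : 0 < (ξ 0 ω).2 := by nlinarith
    refine hω (h1.trans (le_min (by linarith) ?_))
    rw [le_div_iff₀ hp0]
    nlinarith [mul_pos hc hδ]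
  calc _ ≤ _ := measure_mono hsub
    _ ≤ _ := (measure_union_le _ _).trans (add_le_add_right (measure_union_le _ _) _)
    _ = _ := by rw [hu, hfar, hfar, two_mul]

end Law

end CoupledPIMH

namespace CoupledPIMH

/-! ### Product measures with densities -/

section Pi

lemma lintegral_pi_prod_eq_prod_lintegral {N : ℕ} {E : Type*} [MeasurableSpace E] (μ : Measure E)
    [SigmaFinite μ] {f : Fin N → E → ℝ≥0∞} (hf : ∀ i, Measurable (f i)) :
    ∫⁻ x, ∏ i, f i (x i) ∂(Measure.pi fun _ : Fin N => μ) = ∏ i, ∫⁻ x, f i x ∂μ := by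
  induction N with
  | zero => simp
  | succ N ih =>
    have key := (measurePreserving_piFinSuccAbove (fun _ : Fin (N + 1) => μ) 0).symm
    rw [← key.lintegral_comp_emb (MeasurableEquiv.measurableEmbedding _), Fin.prod_univ_succ,
      ← ih fun i => hf i.succ, ← lintegral_prod_mul (hf 0).aemeasurable
        (Finset.measurable_prod _ fun i _ =>
          (hf i.succ).comp (measurable_pi_apply i)).aemeasurable]
    refine lintegral_congr fun p => ?_
    simp [MeasurableEquiv.piFinSuccAbove_symm_apply, Fin.insertNthEquiv, Fin.prod_univ_succ]

lemma pi_withDensity_eq {N : ℕ} {E : Type*} [MeasurableSpace E] (μ : Measure E)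
    [SigmaFinite μ] {f : Fin N → E → ℝ≥0∞} (hf : ∀ i, Measurable (f i))
    [∀ i, SigmaFinite (μ.withDensity (f i))] :
    Measure.pi (fun i => μ.withDensity (f i)) =
      (Measure.pi fun _ : Fin N => μ).withDensity fun x => ∏ i, f i (x i) := by
  refine Measure.pi_eq fun s hs => ?_
  rw [withDensity_apply _ (MeasurableSet.univ_pi hs), ← lintegral_indicator
    (MeasurableSet.univ_pi hs)]
  have hi : ∀ i, μ.withDensity (f i) (s i) = ∫⁻ x, (s i).indicator (f i) x ∂μ := fun i => by
    rw [withDensity_apply _ (hs i), lintegral_indicator (hs i)]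
  rw [Finset.prod_congr rfl fun i _ => hi i]
  rw [← lintegral_pi_prod_eq_prod_lintegral μ fun i => (hf i).indicator (hs i)]
  refine lintegral_congr fun x => ?_
  classical
  by_cases hx : x ∈ Set.univ.pi s
  · rw [Set.indicator_of_mem hx]
    exact Finset.prod_congr rfl fun i _ => (Set.indicator_of_mem (hx i trivial) _).symm
  · rw [Set.indicator_of_notMem hx]
    obtain ⟨i, hi⟩ : ∃ i, x i ∉ s i := by simpa [Set.mem_pi] using hx
    exact (Finset.prod_eq_zero (Finset.mem_univ i) (Set.indicator_of_notMem hi _)).symm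

end Pi

/-! ### Measurability and positivity of the weights -/

section Weights

variable {X Y : Type*} [MeasurableSpace X] [MeasurableSpace Y]
  {νX : Measure X} {νY : Measure Y}
  (M : StateSpaceModel νX νY) (Q : Proposals νX) (y : ℕ → Y) {n N : ℕ}

lemma measurable_weightFirst : Measurable (weightFirst M Q y) := by
  have h1 := M.isDensity_init.1
  have h2 := Q.isDensity_first.1
  have h3 : Measurable fun x => M.obs x (y 0) :=
    M.isTransitionDensity_obs.1.comp measurable_prodMk_right
  unfold weightFirst
  fun_prop

lemma measurable_weightNext (t : ℕ) : Measurable (Function.uncurry (weightNext M Q y t)) := by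
  have h1 := M.isTransitionDensity_trans.1
  have h2 := (Q.isTransitionDensity_next t).1
  have h3 : Measurable fun s : X × X => M.obs s.2 (y (t + 1)) :=
    M.isTransitionDensity_obs.1.comp (measurable_snd.prodMk measurable_const)
  exact (h3.mul h1).div h2

lemma measurable_apply_ancestor (k : Fin n) (i : Fin N) :
    Measurable fun ζ : ParticleSystem X n N => ζ.1 k.castSucc (ζ.2 k i) := by
  have : Measurable fun p : (Fin N → X) × Fin N => p.1 p.2 :=
    measurable_from_prod_countable_left fun j => measurable_pi_apply j
  exact this.comp (f := fun ζ : ParticleSystem X n N => (ζ.1 k.castSucc, ζ.2 k i)) (by fun_prop)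

lemma particleWeight_zero (ζ : ParticleSystem X n N) (i : Fin N) :
    particleWeight M Q y ζ 0 i = weightFirst M Q y (ζ.1 0 i) := rfl

lemma particleWeight_succ (ζ : ParticleSystem X n N) (k : Fin n) (i : Fin N) :
    particleWeight M Q y ζ k.succ i =
      weightNext M Q y k (ζ.1 k.castSucc (ζ.2 k i)) (ζ.1 k.succ i) := rfl

lemma measurable_particleWeight (t : Fin (n + 1)) (i : Fin N) :
    Measurable fun ζ : ParticleSystem X n N => particleWeight M Q y ζ t i := by
  induction t using Fin.cases with
  | zero =>
    simp only [particleWeight_zero]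
    exact (measurable_weightFirst M Q y).comp (by fun_prop)
  | succ k =>
    simp only [particleWeight_succ]
    exact (measurable_weightNext M Q y k).comp
      ((measurable_apply_ancestor k i).prodMk (by fun_prop))

lemma measurable_normWeight (t : Fin (n + 1)) :
    Measurable fun ζ : ParticleSystem X n N => normWeight M Q y ζ t := by
  refine measurable_pi_lambda _ fun i => ?_
  exact (measurable_particleWeight M Q y t i).div
    (Finset.measurable_sum _ fun j _ => measurable_particleWeight M Q y t j)

lemma measurable_likelihoodEstimate :
    Measurable fun ζ : ParticleSystem X n N => likelihoodEstimate M Q y ζ :=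
  Finset.measurable_prod _ fun t _ =>
    (Finset.measurable_sum _ fun j _ => measurable_particleWeight M Q y t j).const_mul _

lemma measurable_filterDensity (R : ResamplingScheme N) :
    Measurable fun ζ : ParticleSystem X n N => filterDensity M Q y R ζ := by
  unfold filterDensity
  refine Measurable.mul (Finset.measurable_prod _ fun i _ => ?_)
    (Finset.measurable_prod _ fun k _ => Measurable.mul ?_ (Finset.measurable_prod _ fun i _ => ?_))
  · exact Q.isDensity_first.1.comp (by fun_prop)
  · have : Measurable fun p : (Fin N → ℝ) × (Fin N → Fin N) => R.prob p.1 p.2 :=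
      measurable_from_prod_countable_left fun a => R.measurable_prob a
    exact this.comp (f := fun ζ : ParticleSystem X n N =>
      (normWeight M Q y ζ k.castSucc, ζ.2 k)) ((measurable_normWeight M Q y _).prodMk (by fun_prop))
  · exact (Q.isTransitionDensity_next k).1.comp
      ((measurable_apply_ancestor k i).prodMk (by fun_prop))

lemma filterDensity_nonneg (R : ResamplingScheme N) (ζ : ParticleSystem X n N) :
    0 ≤ filterDensity M Q y R ζ :=
  mul_nonneg (Finset.prod_nonneg fun _ _ => Q.isDensity_first.2.1 _)
    (Finset.prod_nonneg fun k _ => mul_nonneg (R.prob_nonneg _ _)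
      (Finset.prod_nonneg fun _ _ => (Q.isTransitionDensity_next k).2.1 _ _))

variable {M Q y}

lemma particleWeight_pos (h0 : ∀ x, 0 < weightFirst M Q y x)
    (h1 : ∀ t < n, ∀ x x', 0 < weightNext M Q y t x x') (ζ : ParticleSystem X n N)
    (t : Fin (n + 1)) (i : Fin N) : 0 < particleWeight M Q y ζ t i := by
  induction t using Fin.cases with
  | zero => exact h0 _
  | succ k => exact h1 k k.2 _ _

lemma sum_particleWeight_pos (h0 : ∀ x, 0 < weightFirst M Q y x)
    (h1 : ∀ t < n, ∀ x x', 0 < weightNext M Q y t x x') (hN : 1 ≤ N) (ζ : ParticleSystem X n N)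
    (t : Fin (n + 1)) : 0 < ∑ i, particleWeight M Q y ζ t i := by
  have : Nonempty (Fin N) := ⟨⟨0, hN⟩⟩
  exact Finset.sum_pos (fun i _ => particleWeight_pos h0 h1 ζ t i) Finset.univ_nonempty

lemma normWeight_mem_stdSimplex (h0 : ∀ x, 0 < weightFirst M Q y x)
    (h1 : ∀ t < n, ∀ x x', 0 < weightNext M Q y t x x') (hN : 1 ≤ N) (ζ : ParticleSystem X n N)
    (t : Fin (n + 1)) : normWeight M Q y ζ t ∈ stdSimplex ℝ (Fin N) := by
  have hpos := sum_particleWeight_pos h0 h1 hN ζ t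
  refine ⟨fun i => div_nonneg (particleWeight_pos h0 h1 ζ t i).le hpos.le, ?_⟩
  unfold normWeight
  rw [← Finset.sum_div, div_self hpos.ne']

lemma likelihoodEstimate_pos (h0 : ∀ x, 0 < weightFirst M Q y x)
    (h1 : ∀ t < n, ∀ x x', 0 < weightNext M Q y t x x') (hN : 1 ≤ N)
    (ζ : ParticleSystem X n N) : 0 < likelihoodEstimate M Q y ζ := by
  have : (0 : ℝ) < N := by exact_mod_cast hN
  exact Finset.prod_pos fun t _ =>
    mul_pos (by positivity) (sum_particleWeight_pos h0 h1 hN ζ t)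

end Weights

/-! ### One step of the particle filter -/

section Step

variable {X Y : Type*} [MeasurableSpace X] [MeasurableSpace Y]
  {νX : Measure X} {νY : Measure Y} [SigmaFinite νX]
  (M : StateSpaceModel νX νY) (Q : Proposals νX) (y : ℕ → Y) {n N : ℕ}

/-- The law of a particle at the first time. -/
noncomputable def initialLaw : Measure X := νX.withDensity fun x => ENNReal.ofReal (Q.first x)

/-- The Markov kernel that moves a particle from time `t` to time `t + 1`. -/
noncomputable def moveKernel (t : ℕ) : Kernel X X :=
  (Kernel.const X νX).withDensity fun x x' => ENNReal.ofReal (Q.next t x x')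

instance isProbabilityMeasure_initialLaw : IsProbabilityMeasure (initialLaw Q) :=
  ⟨by rw [initialLaw, withDensity_apply _ MeasurableSet.univ, Measure.restrict_univ]
      exact Q.isDensity_first.2.2⟩

omit [SigmaFinite νX] in
lemma measurable_ofReal_next (t : ℕ) :
    Measurable (Function.uncurry fun x x' => ENNReal.ofReal (Q.next t x x')) :=
  ENNReal.measurable_ofReal.comp (Q.isTransitionDensity_next t).1

lemma moveKernel_apply (t : ℕ) (x : X) :
    moveKernel Q t x = νX.withDensity fun x' => ENNReal.ofReal (Q.next t x x') := by
  rw [moveKernel, Kernel.withDensity_apply _ (measurable_ofReal_next Q t), Kernel.const_apply]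

instance isMarkovKernel_moveKernel (t : ℕ) : IsMarkovKernel (moveKernel Q t) :=
  ⟨fun x => ⟨by
    rw [moveKernel_apply, withDensity_apply _ MeasurableSet.univ, Measure.restrict_univ]
    exact (Q.isTransitionDensity_next t).2.2 x⟩⟩

/-- The particle system `ζ` prolonged by one step, with ancestors `a` and new particles `x`. -/
def extend (ζ : ParticleSystem X n N) (a : Fin N → Fin N) (x : Fin N → X) :
    ParticleSystem X (n + 1) N :=
  (Fin.snoc (α := fun _ => Fin N → X) ζ.1 x, Fin.snoc (α := fun _ => Fin N → Fin N) ζ.2 a)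

omit [MeasurableSpace X] in
@[simp]
lemma extend_fst_last (ζ : ParticleSystem X n N) (a : Fin N → Fin N) (x : Fin N → X) :
    (extend ζ a x).1 (Fin.last (n + 1)) = x := by simp [extend]

omit [MeasurableSpace X] in
@[simp]
lemma extend_fst_castSucc (ζ : ParticleSystem X n N) (a : Fin N → Fin N) (x : Fin N → X)
    (t : Fin (n + 1)) : (extend ζ a x).1 t.castSucc = ζ.1 t := by simp [extend]

omit [MeasurableSpace X] in
@[simp]
lemma extend_snd_last (ζ : ParticleSystem X n N) (a : Fin N → Fin N) (x : Fin N → X) :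
    (extend ζ a x).2 (Fin.last n) = a := by simp [extend]

omit [MeasurableSpace X] in
@[simp]
lemma extend_snd_castSucc (ζ : ParticleSystem X n N) (a : Fin N → Fin N) (x : Fin N → X)
    (k : Fin n) : (extend ζ a x).2 k.castSucc = ζ.2 k := by simp [extend]

omit [SigmaFinite νX] in
@[simp]
lemma particleWeight_extend_castSucc (ζ : ParticleSystem X n N) (a : Fin N → Fin N)
    (x : Fin N → X) (t : Fin (n + 1)) (i : Fin N) :
    particleWeight M Q y (extend ζ a x) t.castSucc i = particleWeight M Q y ζ t i := by
  induction t using Fin.cases with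
  | zero =>
    rw [Fin.castSucc_zero, particleWeight_zero, particleWeight_zero, ← Fin.castSucc_zero,
      extend_fst_castSucc]
  | succ k =>
    rw [← Fin.succ_castSucc, particleWeight_succ, particleWeight_succ, Fin.succ_castSucc,
      extend_fst_castSucc, extend_fst_castSucc, extend_snd_castSucc, Fin.val_castSucc]

omit [SigmaFinite νX] in
@[simp]
lemma particleWeight_extend_last (ζ : ParticleSystem X n N) (a : Fin N → Fin N)
    (x : Fin N → X) (i : Fin N) :
    particleWeight M Q y (extend ζ a x) (Fin.last (n + 1)) i =
      weightNext M Q y n (ζ.1 (Fin.last n) (a i)) (x i) := by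
  rw [← Fin.succ_last, particleWeight_succ, Fin.succ_last, extend_fst_last, extend_fst_castSucc,
    extend_snd_last, Fin.val_last]

omit [SigmaFinite νX] in
@[simp]
lemma normWeight_extend_castSucc (ζ : ParticleSystem X n N) (a : Fin N → Fin N)
    (x : Fin N → X) (t : Fin (n + 1)) :
    normWeight M Q y (extend ζ a x) t.castSucc = normWeight M Q y ζ t := by
  ext i
  simp [normWeight]

omit [SigmaFinite νX] in
lemma filterDensity_extend (R : ResamplingScheme N) (ζ : ParticleSystem X n N)
    (a : Fin N → Fin N) (x : Fin N → X) :
    filterDensity M Q y R (extend ζ a x) = filterDensity M Q y R ζ *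
      (R.prob (normWeight M Q y ζ (Fin.last n)) a *
        ∏ i, Q.next n (ζ.1 (Fin.last n) (a i)) (x i)) := by
  unfold filterDensity
  rw [Fin.prod_univ_castSucc, ← mul_assoc]
  congr 1
  · have : (extend ζ a x).1 0 = ζ.1 0 := by
      rw [← Fin.castSucc_zero, extend_fst_castSucc]
    rw [this]
    congr 1
    · refine Finset.prod_congr rfl fun k _ => ?_
      rw [normWeight_extend_castSucc, extend_fst_castSucc, extend_snd_castSucc,
        Fin.succ_castSucc, extend_fst_castSucc, Fin.val_castSucc]
  · rw [normWeight_extend_castSucc, extend_fst_castSucc, extend_snd_last, Fin.succ_last,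
      extend_fst_last, Fin.val_last]

lemma measurable_extend :
    Measurable fun p : ParticleSystem X n N × (Fin N → Fin N) × (Fin N → X) =>
      extend p.1 p.2.1 p.2.2 := by
  refine Measurable.prodMk ?_ ?_
  · refine measurable_pi_lambda _ fun t => ?_
    induction t using Fin.lastCases with
    | last => simpa [extend] using measurable_snd.snd
    | cast t =>
      simp only [Fin.snoc_castSucc]
      fun_prop
  · refine measurable_pi_lambda _ fun t => ?_
    induction t using Fin.lastCases with
    | last => simpa [extend] using measurable_snd.fst
    | cast t =>
      simp only [Fin.snoc_castSucc]
      fun_prop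

omit [MeasurableSpace X] in
lemma sum_pi_snoc {A : Type*} [Fintype A] [DecidableEq A] (F : (Fin (n + 1) → A) → ℝ≥0∞) :
    ∑ as, F as = ∑ as : Fin n → A, ∑ a, F (Fin.snoc (α := fun _ => A) as a) := by
  rw [← (Fin.snocEquiv fun _ : Fin (n + 1) => A).sum_comp, Fintype.sum_prod_type,
    Finset.sum_comm]
  rfl

lemma lintegral_pi_snoc {A : Type*} [MeasurableSpace A] (μ : Measure A) [SigmaFinite μ]
    {F : (Fin (n + 1) → A) → ℝ≥0∞} (hF : Measurable F) :
    ∫⁻ xs, F xs ∂(Measure.pi fun _ : Fin (n + 1) => μ) =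
      ∫⁻ xs, ∫⁻ x, F (Fin.snoc (α := fun _ => A) xs x) ∂μ ∂(Measure.pi fun _ : Fin n => μ) := by
  have key := (measurePreserving_piFinSuccAbove (fun _ : Fin (n + 1) => μ) (Fin.last n)).symm
  rw [← key.lintegral_comp_emb (MeasurableEquiv.measurableEmbedding _), lintegral_prod_symm]
  · refine lintegral_congr fun xs => lintegral_congr fun x => ?_
    simp [MeasurableEquiv.piFinSuccAbove_symm_apply, Fin.insertNthEquiv, Fin.insertNth_last']
  · exact (hF.comp (MeasurableEquiv.measurable _)).aemeasurable

omit [SigmaFinite νX] in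
lemma lintegral_systemMeasure {F : ParticleSystem X n N → ℝ≥0∞} (hF : Measurable F) :
    ∫⁻ ζ, F ζ ∂(systemMeasure νX n N) =
      ∫⁻ xs, ∑ as, F (xs, as)
        ∂(Measure.pi fun _ : Fin (n + 1) => Measure.pi fun _ : Fin N => νX) := by
  rw [systemMeasure, lintegral_prod _ hF.aemeasurable]
  simp_rw [lintegral_count, tsum_fintype]

lemma lintegral_systemMeasure_succ {F : ParticleSystem X (n + 1) N → ℝ≥0∞} (hF : Measurable F) :
    ∫⁻ ζ, F ζ ∂(systemMeasure νX (n + 1) N) =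
      ∫⁻ ζ, ∑ a, ∫⁻ x, F (extend ζ a x) ∂(Measure.pi fun _ : Fin N => νX)
        ∂(systemMeasure νX n N) := by
  have hFe : ∀ a, Measurable fun p : ParticleSystem X n N × (Fin N → X) =>
      F (extend p.1 a p.2) := fun a => hF.comp <| measurable_extend.comp
        (measurable_fst.prodMk (measurable_const.prodMk measurable_snd))
  have hFx : ∀ ζ a, Measurable fun x : Fin N → X => F (extend ζ a x) := fun ζ a =>
    (hFe a).comp measurable_prodMk_left
  rw [lintegral_systemMeasure hF, lintegral_systemMeasure, lintegral_pi_snoc]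
  · refine lintegral_congr fun xs => ?_
    simp_rw [sum_pi_snoc]
    change ∫⁻ x, ∑ as, ∑ a, F (extend (xs, as) a x) ∂_ = _
    rw [lintegral_finsetSum _ fun as _ => Finset.measurable_sum _ fun a _ => hFx (xs, as) a]
    refine Finset.sum_congr rfl fun as _ => ?_
    rw [lintegral_finsetSum _ fun a _ => hFx (xs, as) a]
  · exact Finset.measurable_sum _ fun a _ => hF.comp measurable_prodMk_right
  · exact Finset.measurable_sum _ fun a _ => (hFe a).lintegral_prod_right'

/-- The law of the filter run up to time `n + 1` is obtained from the one up to time `n` by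
drawing ancestors and moving the particles. -/
lemma lintegral_systemLaw_succ (R : ResamplingScheme N) {F : ParticleSystem X (n + 1) N → ℝ≥0∞}
    (hF : Measurable F) :
    ∫⁻ ζ, F ζ ∂(systemLaw M Q y (n + 1) R) =
      ∫⁻ ζ, ∑ a, ENNReal.ofReal (R.prob (normWeight M Q y ζ (Fin.last n)) a) *
        ∫⁻ x, F (extend ζ a x)
          ∂(Measure.pi fun i => moveKernel Q n (ζ.1 (Fin.last n) (a i)))
        ∂(systemLaw M Q y n R) := by
  have hdens : ∀ m, Measurable fun ζ : ParticleSystem X m N =>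
      ENNReal.ofReal (filterDensity M Q y R ζ) := fun m =>
    ENNReal.measurable_ofReal.comp (measurable_filterDensity M Q y R)
  have hFe : ∀ a, Measurable fun p : ParticleSystem X n N × (Fin N → X) =>
      F (extend p.1 a p.2) := fun a => hF.comp <| measurable_extend.comp
        (measurable_fst.prodMk (measurable_const.prodMk measurable_snd))
  have hprob : ∀ a, Measurable fun ζ : ParticleSystem X n N =>
      ENNReal.ofReal (R.prob (normWeight M Q y ζ (Fin.last n)) a) := fun a =>
    ENNReal.measurable_ofReal.comp ((R.measurable_prob a).comp (measurable_normWeight M Q y _))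
  have hprod : ∀ a : Fin N → Fin N, Measurable fun p : ParticleSystem X n N × (Fin N → X) =>
      ∏ i, ENNReal.ofReal (Q.next n (p.1.1 (Fin.last n) (a i)) (p.2 i)) := fun a =>
    Finset.measurable_prod _ fun i _ => (measurable_ofReal_next Q n).comp
      (f := fun p : ParticleSystem X n N × (Fin N → X) => (p.1.1 (Fin.last n) (a i), p.2 i))
      (by fun_prop)
  have hmove : ∀ (ζ : ParticleSystem X n N) (a : Fin N → Fin N), ∫⁻ x, F (extend ζ a x)
      ∂(Measure.pi fun i => moveKernel Q n (ζ.1 (Fin.last n) (a i))) =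
      ∫⁻ x, (∏ i, ENNReal.ofReal (Q.next n (ζ.1 (Fin.last n) (a i)) (x i))) * F (extend ζ a x)
        ∂(Measure.pi fun _ : Fin N => νX) := by
    intro ζ a
    have hq : ∀ i, Measurable fun x' =>
        ENNReal.ofReal (Q.next n (ζ.1 (Fin.last n) (a i)) x') := fun i =>
      (measurable_ofReal_next Q n).comp measurable_prodMk_left
    have hprobm : ∀ i, IsProbabilityMeasure (νX.withDensity fun x' =>
        ENNReal.ofReal (Q.next n (ζ.1 (Fin.last n) (a i)) x')) := fun i => by
      rw [← moveKernel_apply]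
      infer_instance
    simp_rw [moveKernel_apply]
    have h1 : Measurable fun x : Fin N → X =>
        ∏ i, ENNReal.ofReal (Q.next n (ζ.1 (Fin.last n) (a i)) (x i)) :=
      (hprod a).comp measurable_prodMk_left
    have h2 : Measurable fun x : Fin N → X => F (extend ζ a x) :=
      (hFe a).comp measurable_prodMk_left
    rw [pi_withDensity_eq νX hq, lintegral_withDensity_eq_lintegral_mul _ h1 h2]
    rfl
  have hinner : Measurable fun ζ : ParticleSystem X n N =>
      ∑ a : Fin N → Fin N, ENNReal.ofReal (R.prob (normWeight M Q y ζ (Fin.last n)) a) *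
        ∫⁻ x, (∏ i, ENNReal.ofReal (Q.next n (ζ.1 (Fin.last n) (a i)) (x i))) * F (extend ζ a x)
          ∂(Measure.pi fun _ : Fin N => νX) :=
    Finset.measurable_sum _ fun a _ => (hprob a).mul
      ((hprod a).mul (hFe a)).lintegral_prod_right'
  simp_rw [hmove]
  rw [systemLaw, systemLaw, lintegral_withDensity_eq_lintegral_mul _ (hdens _) hF,
    lintegral_systemMeasure_succ ((hdens _).mul hF), lintegral_withDensity_eq_lintegral_mul _
    (hdens _) hinner]
  refine lintegral_congr fun ζ => ?_
  rw [Pi.mul_apply, Finset.mul_sum]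
  refine Finset.sum_congr rfl fun a _ => ?_
  have hm : Measurable fun x : Fin N → X =>
      (∏ i, ENNReal.ofReal (Q.next n (ζ.1 (Fin.last n) (a i)) (x i))) * F (extend ζ a x) :=
    ((hprod a).mul (hFe a)).comp measurable_prodMk_left
  rw [← lintegral_const_mul _ hm, ← lintegral_const_mul _ (hm.const_mul _)]
  refine lintegral_congr fun x => ?_
  rw [Pi.mul_apply, filterDensity_extend, ENNReal.ofReal_mul (filterDensity_nonneg M Q y R ζ),
    ENNReal.ofReal_mul (R.prob_nonneg _ _), ENNReal.ofReal_prod_of_nonneg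
      fun i _ => (Q.isTransitionDensity_next n).2.1 _ _]
  ring

lemma sum_ofReal_prob (R : ResamplingScheme N) (W : Fin N → ℝ) :
    ∑ a, ENNReal.ofReal (R.prob W a) = 1 := by
  rw [← ENNReal.ofReal_sum_of_nonneg fun a _ => R.prob_nonneg W a, R.sum_prob, ENNReal.ofReal_one]

/-- The filter run up to time `n + 1` and stopped at time `n` is the filter run up to time `n`. -/
lemma lintegral_systemLaw_succ_of_extend (R : ResamplingScheme N)
    {F : ParticleSystem X (n + 1) N → ℝ≥0∞} (hF : Measurable F) {G : ParticleSystem X n N → ℝ≥0∞}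
    (hG : ∀ ζ a x, F (extend ζ a x) = G ζ) :
    ∫⁻ ζ, F ζ ∂(systemLaw M Q y (n + 1) R) = ∫⁻ ζ, G ζ ∂(systemLaw M Q y n R) := by
  rw [lintegral_systemLaw_succ M Q y R hF]
  refine lintegral_congr fun ζ => ?_
  simp_rw [hG]
  simp [← Finset.sum_mul, sum_ofReal_prob]

/-- At the first time the particles are independent draws from the first proposal. -/
lemma lintegral_systemLaw_zero (R : ResamplingScheme N) {F : ParticleSystem X 0 N → ℝ≥0∞}
    (hF : Measurable F) :
    ∫⁻ ζ, F ζ ∂(systemLaw M Q y 0 R) =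
      ∫⁻ x, F (fun _ => x, Fin.elim0) ∂(Measure.pi fun _ : Fin N => initialLaw Q) := by
  have hfirst : Measurable fun x => ENNReal.ofReal (Q.first x) :=
    ENNReal.measurable_ofReal.comp Q.isDensity_first.1
  have hprob : IsProbabilityMeasure (νX.withDensity fun x => ENNReal.ofReal (Q.first x)) :=
    isProbabilityMeasure_initialLaw Q
  have hdens : Measurable fun ζ : ParticleSystem X 0 N =>
      ENNReal.ofReal (filterDensity M Q y R ζ) :=
    ENNReal.measurable_ofReal.comp (measurable_filterDensity M Q y R)
  have hconst : Measurable fun x : Fin N → X => ((fun _ => x, Fin.elim0) : ParticleSystem X 0 N) :=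
    Measurable.prodMk (measurable_pi_lambda _ fun _ => measurable_id) measurable_const
  have hG : Measurable ((fun ζ : ParticleSystem X 0 N =>
      ENNReal.ofReal (filterDensity M Q y R ζ)) * F) := hdens.mul hF
  have hG' : Measurable fun xs : Fin 1 → Fin N → X => ∑ as, ((fun ζ : ParticleSystem X 0 N =>
      ENNReal.ofReal (filterDensity M Q y R ζ)) * F) (xs, as) :=
    Finset.measurable_sum _ fun a _ => hG.comp measurable_prodMk_right
  have hprod : Measurable fun x : Fin N → X => ∏ i, ENNReal.ofReal (Q.first (x i)) :=
    Finset.measurable_prod _ fun i _ => hfirst.comp (measurable_pi_apply i)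
  have hF' : Measurable fun x : Fin N → X => F (fun _ => x, Fin.elim0) := hF.comp hconst
  have hpi : (Measure.pi fun _ : Fin N => initialLaw Q) =
      (Measure.pi fun _ : Fin N => νX).withDensity fun x => ∏ i, ENNReal.ofReal (Q.first (x i)) :=
    pi_withDensity_eq νX fun _ => hfirst
  rw [systemLaw, lintegral_withDensity_eq_lintegral_mul _ hdens hF, lintegral_systemMeasure hG,
    lintegral_pi_snoc _ hG', hpi, lintegral_withDensity_eq_lintegral_mul _ hprod hF']
  have hx : ∀ (xs : Fin 0 → Fin N → X) (x : Fin N → X),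
      Fin.snoc (n := 0) (α := fun _ => Fin N → X) xs x = fun _ => x := by
    intro xs x
    funext t
    have ht : t = Fin.last 0 := Subsingleton.elim (α := Fin 1) _ _
    rw [ht, Fin.snoc_last]
  simp only [Finset.univ_unique, Finset.sum_singleton, hx, lintegral_const, Measure.pi_empty_univ,
    mul_one]
  refine lintegral_congr fun x => ?_
  rw [Subsingleton.elim default Fin.elim0]
  simp only [Pi.mul_apply, filterDensity, Finset.univ_eq_empty, Finset.prod_empty, mul_one]
  rw [ENNReal.ofReal_prod_of_nonneg fun i _ => Q.isDensity_first.2.1 _]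

instance isProbabilityMeasure_systemLaw (R : ResamplingScheme N) :
    IsProbabilityMeasure (systemLaw M Q y n R) := by
  refine ⟨?_⟩
  rw [← lintegral_one]
  induction n with
  | zero => rw [lintegral_systemLaw_zero M Q y R measurable_const]; simp
  | succ n ih =>
    rw [lintegral_systemLaw_succ_of_extend M Q y R measurable_const (G := fun _ => 1)
      fun _ _ _ => rfl, ih]

end Step

end CoupledPIMH

namespace CoupledPIMH

/-! ### Quadratic errors of averages -/

section Quadratic

/-- The quadratic error of an average of independent bounded variables: its variance is of order
`1 / N`, and the bias is computed from the means. -/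
lemma lintegral_pi_sq_average_le {N : ℕ} (hN : 1 ≤ N) {E : Type*} [MeasurableSpace E]
    (ρ : Fin N → Measure E) [∀ i, IsProbabilityMeasure (ρ i)] {h : Fin N → E → ℝ}
    (hm : ∀ i, Measurable (h i)) {B : ℝ} (hB : ∀ i x, |h i x| ≤ B) (c d : ℝ) :
    ∫⁻ x, ENNReal.ofReal ((c * ((1 / (N : ℝ)) * ∑ i, h i (x i)) - d) ^ 2) ∂(Measure.pi ρ) ≤
      ENNReal.ofReal (c ^ 2 * B ^ 2 / N +
        (c * ((1 / (N : ℝ)) * ∑ i, ∫ x, h i x ∂(ρ i)) - d) ^ 2) := by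
  have hLp : ∀ i, MemLp (h i) 2 (ρ i) := fun i =>
    MemLp.of_bound (hm i).aestronglyMeasurable B (ae_of_all _ fun x => hB i x)
  have hLp' : ∀ i, MemLp (fun x : Fin N → E => h i (x i)) 2 (Measure.pi ρ) := fun i =>
    MemLp.of_bound ((hm i).comp (measurable_pi_apply i)).aestronglyMeasurable B
      (ae_of_all _ fun x => hB i (x i))
  have hint : ∀ i, Integrable (fun x : Fin N → E => h i (x i)) (Measure.pi ρ) := fun i =>
    (hLp' i).integrable one_le_two
  set S : (Fin N → E) → ℝ := fun x => ∑ i, h i (x i) with hS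
  have hS2 : MemLp S 2 (Measure.pi ρ) := memLp_finsetSum _ fun i _ => hLp' i
  have hmean : ∫ x, S x ∂(Measure.pi ρ) = ∑ i, ∫ x, h i x ∂(ρ i) := by
    rw [integral_finsetSum _ fun i _ => hint i]
    exact Finset.sum_congr rfl fun i _ => integral_comp_eval (hm i).aestronglyMeasurable
  have hvar : Var[S; Measure.pi ρ] ≤ N * B ^ 2 := by
    have hS' : S = ∑ i, fun x : Fin N → E => h i (x i) := by
      ext x
      simp [hS]
    rw [hS', variance_sum_pi hLp]
    calc ∑ i, Var[h i; ρ i] ≤ ∑ _i : Fin N, B ^ 2 := by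
          refine Finset.sum_le_sum fun i _ => ?_
          have := variance_le_sq_of_bounded (μ := ρ i) (X := h i) (a := -B) (b := B)
            (ae_of_all _ fun x => abs_le.1 (hB i x)) (hm i).aemeasurable
          refine this.trans_eq (by ring)
      _ = N * B ^ 2 := by simp
  set T : (Fin N → E) → ℝ := fun x => c * ((1 / (N : ℝ)) * S x) - d with hT
  have hT2 : MemLp T 2 (Measure.pi ρ) :=
    ((hS2.const_mul (1 / (N : ℝ))).const_mul c).sub (memLp_const d)
  have hTmean : ∫ x, T x ∂(Measure.pi ρ) =
      c * ((1 / (N : ℝ)) * ∑ i, ∫ x, h i x ∂(ρ i)) - d := by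
    have hSi := hS2.integrable one_le_two
    rw [hT, integral_sub ((hSi.const_mul _).const_mul _) (integrable_const _),
      integral_const_mul, integral_const_mul, hmean]
    simp
  have hTvar : Var[T; Measure.pi ρ] ≤ c ^ 2 * B ^ 2 / N := by
    have hTS : T = fun x => (c * (1 / (N : ℝ))) * S x - d := by
      ext x
      rw [hT]
      ring
    have hNpos : (0 : ℝ) < N := by exact_mod_cast hN
    rw [hTS, variance_sub_const (hS2.aestronglyMeasurable.const_mul _), variance_const_mul]
    calc (c * (1 / (N : ℝ))) ^ 2 * Var[S; Measure.pi ρ]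
        ≤ (c * (1 / (N : ℝ))) ^ 2 * (N * B ^ 2) :=
          mul_le_mul_of_nonneg_left hvar (sq_nonneg _)
      _ = c ^ 2 * B ^ 2 / N := by field_simp
  have hsq := variance_eq_sub hT2
  rw [← ofReal_integral_eq_lintegral_ofReal hT2.integrable_sq (ae_of_all _ fun x => sq_nonneg _)]
  refine ENNReal.ofReal_le_ofReal ?_
  rw [← hTmean]
  have : ∫ x, T x ^ 2 ∂(Measure.pi ρ) = Var[T; Measure.pi ρ] + (∫ x, T x ∂(Measure.pi ρ)) ^ 2 := by
    rw [hsq]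
    simp only [Pi.pow_apply]
    ring
  rw [this]
  linarith

variable {N : ℕ} (R : ResamplingScheme N)

lemma ResamplingScheme.IsUnbiased.sum_prob_mul_average {R : ResamplingScheme N}
    (hR : R.IsUnbiased) (hN : 1 ≤ N) {W : Fin N → ℝ} (hW : W ∈ stdSimplex ℝ (Fin N))
    (φ : Fin N → ℝ) :
    ∑ a, R.prob W a * ((1 / (N : ℝ)) * ∑ i, φ (a i)) = ∑ k, W k * φ k := by
  have hNpos : (N : ℝ) ≠ 0 := by exact_mod_cast (by omega : N ≠ 0)
  have hφ : ∀ j, φ j = ∑ k, if j = k then φ k else 0 := fun j => by simp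
  calc ∑ a, R.prob W a * ((1 / (N : ℝ)) * ∑ i, φ (a i))
      = ∑ a, ∑ i, ∑ k, (1 / (N : ℝ)) * φ k * (if a i = k then R.prob W a else 0) := by
        refine Finset.sum_congr rfl fun a _ => ?_
        rw [Finset.mul_sum, Finset.mul_sum]
        refine Finset.sum_congr rfl fun i _ => ?_
        nth_rw 1 [hφ (a i)]
        rw [Finset.mul_sum, Finset.mul_sum]
        refine Finset.sum_congr rfl fun k _ => ?_
        split_ifs <;> ring
    _ = ∑ k, ∑ i, ∑ a, (1 / (N : ℝ)) * φ k * (if a i = k then R.prob W a else 0) := by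
        rw [Finset.sum_comm, Finset.sum_congr rfl fun i _ => Finset.sum_comm, Finset.sum_comm]
    _ = ∑ k, W k * φ k := by
        refine Finset.sum_congr rfl fun k _ => ?_
        simp_rw [← Finset.mul_sum]
        rw [hR W hW k]
        field_simp

/-- Decomposition of the quadratic error of a resampled average into variance and bias. -/
lemma ResamplingScheme.sum_prob_mul_sq (W φ : Fin N → ℝ) (p g : ℝ) :
    ∑ a, R.prob W a * (p * ((1 / (N : ℝ)) * ∑ i, φ (a i)) - g) ^ 2 =
      p ^ 2 * R.variance W φ +
        (p * (∑ a, R.prob W a * ((1 / (N : ℝ)) * ∑ i, φ (a i))) - g) ^ 2 := by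
  unfold ResamplingScheme.variance
  set A : (Fin N → Fin N) → ℝ := fun a => (1 / (N : ℝ)) * ∑ i, φ (a i)
  set m := ∑ a, R.prob W a * A a with hm
  have h1 := R.sum_prob W
  have hcross : ∑ a, R.prob W a * (A a - m) = 0 := by
    simp_rw [mul_sub, Finset.sum_sub_distrib, ← Finset.sum_mul, h1, one_mul, hm, sub_self]
  calc ∑ a, R.prob W a * (p * A a - g) ^ 2
      = ∑ a, (p ^ 2 * (R.prob W a * (A a - m) ^ 2) +
          2 * p * (p * m - g) * (R.prob W a * (A a - m)) + R.prob W a * (p * m - g) ^ 2) :=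
        Finset.sum_congr rfl fun a _ => by ring
    _ = p ^ 2 * ∑ a, R.prob W a * (A a - m) ^ 2 + (p * m - g) ^ 2 := by
        rw [Finset.sum_add_distrib, Finset.sum_add_distrib, ← Finset.mul_sum, ← Finset.mul_sum,
          ← Finset.sum_mul, hcross, h1]
        ring

lemma ResamplingScheme.variance_nonneg (W φ : Fin N → ℝ) : 0 ≤ R.variance W φ :=
  Finset.sum_nonneg fun a _ => mul_nonneg (R.prob_nonneg W a) (sq_nonneg _)

lemma ResamplingScheme.variance_le {φ : Fin N → ℝ} {B : ℝ} (hB : ∀ i, |φ i| ≤ B) (hN : 1 ≤ N)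
    (W : Fin N → ℝ) : R.variance W φ ≤ B ^ 2 := by
  have hNpos : (0 : ℝ) < N := by exact_mod_cast hN
  have h := R.sum_prob_mul_sq W φ 1 0
  have hle : ∑ a, R.prob W a * (1 * ((1 / (N : ℝ)) * ∑ i, φ (a i)) - 0) ^ 2 ≤ B ^ 2 := by
    calc _ ≤ ∑ a, R.prob W a * B ^ 2 := by
          refine Finset.sum_le_sum fun a _ => mul_le_mul_of_nonneg_left ?_ (R.prob_nonneg W a)
          rw [one_mul, sub_zero]
          refine sq_le_sq' ?_ ?_ <;>
          · have hs : |∑ i, φ (a i)| ≤ N * B :=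
              (Finset.abs_sum_le_sum_abs _ _).trans
                ((Finset.sum_le_sum fun i _ => hB (a i)).trans_eq (by simp))
            rw [abs_le] at hs
            rw [one_div, inv_mul_eq_div]
            first
              | rw [le_div_iff₀ hNpos]; linarith
              | rw [div_le_iff₀ hNpos]; linarith
      _ = B ^ 2 := by rw [← Finset.sum_mul, R.sum_prob, one_mul]
  rw [h] at hle
  nlinarith [sq_nonneg (1 * (∑ a, R.prob W a * ((1 / (N : ℝ)) * ∑ i, φ (a i))) - 0)]

end Quadratic

/-! ### Mean square convergence of the filter estimates -/

section Convergence

variable {X Y : Type*} [MeasurableSpace X] [MeasurableSpace Y]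
  {νX : Measure X} {νY : Measure Y}
  (M : StateSpaceModel νX νY) (Q : Proposals νX) (y : ℕ → Y) {n N : ℕ}

/-- The filter's estimate `p_N(y_{0:n}) ∑ i, W_n^i φ (X_n^i)` of the unnormalised filtering
integral of `φ`, with the last factor of `p_N` multiplied out. -/
noncomputable def filterEstimate (ζ : ParticleSystem X n N) (φ : X → ℝ) : ℝ :=
  (∏ t : Fin n, ((1 / (N : ℝ)) * ∑ i, particleWeight M Q y ζ t.castSucc i)) *
    ((1 / (N : ℝ)) * ∑ i, particleWeight M Q y ζ (Fin.last n) i * φ (ζ.1 (Fin.last n) i))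

lemma filterEstimate_one (ζ : ParticleSystem X n N) :
    filterEstimate M Q y ζ (fun _ => 1) = likelihoodEstimate M Q y ζ := by
  simp [filterEstimate, likelihoodEstimate, Fin.prod_univ_castSucc]

lemma filterEstimate_eq_likelihoodEstimate_mul {ζ : ParticleSystem X n N}
    (h : 0 < ∑ i, particleWeight M Q y ζ (Fin.last n) i) (φ : X → ℝ) :
    filterEstimate M Q y ζ φ = likelihoodEstimate M Q y ζ *
      ∑ k, normWeight M Q y ζ (Fin.last n) k * φ (ζ.1 (Fin.last n) k) := by
  unfold filterEstimate likelihoodEstimate normWeight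
  rw [Fin.prod_univ_castSucc]
  simp_rw [div_mul_eq_mul_div, ← Finset.sum_div]
  field_simp

lemma filterEstimate_extend (ζ : ParticleSystem X n N) (a : Fin N → Fin N) (x : Fin N → X)
    (φ : X → ℝ) :
    filterEstimate M Q y (extend ζ a x) φ = likelihoodEstimate M Q y ζ *
      ((1 / (N : ℝ)) * ∑ i, weightNext M Q y n (ζ.1 (Fin.last n) (a i)) (x i) * φ (x i)) := by
  simp [filterEstimate, likelihoodEstimate]

lemma measurable_filterEstimate {φ : X → ℝ} (hφ : Measurable φ) :
    Measurable fun ζ : ParticleSystem X n N => filterEstimate M Q y ζ φ := by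
  refine Measurable.mul ?_ (Measurable.const_mul (Finset.measurable_sum _ fun i _ =>
    (measurable_particleWeight M Q y _ i).mul (hφ.comp (by fun_prop))) _)
  exact Finset.measurable_prod _ fun t _ =>
    (Finset.measurable_sum _ fun j _ => measurable_particleWeight M Q y _ j).const_mul _

lemma measurable_noise (R : ResamplingScheme N) (t : Fin (n + 1)) {φ : X → ℝ}
    (hφ : Measurable φ) :
    Measurable fun ζ : ParticleSystem X n N =>
      R.variance (normWeight M Q y ζ t) fun i => φ (ζ.1 t i) := by
  have h1 : ∀ a, Measurable fun ζ : ParticleSystem X n N => R.prob (normWeight M Q y ζ t) a :=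
    fun a => (R.measurable_prob a).comp (measurable_normWeight M Q y t)
  have h2 : ∀ a : Fin N → Fin N, Measurable fun ζ : ParticleSystem X n N =>
      (1 / (N : ℝ)) * ∑ i, φ (ζ.1 t (a i)) := fun a =>
    (Finset.measurable_sum _ fun i _ => hφ.comp (by fun_prop)).const_mul _
  exact Finset.measurable_sum _ fun a _ => (h1 a).mul
    (((h2 a).sub (Finset.measurable_sum _ fun a' _ => (h1 a').mul (h2 a'))).pow_const 2)

variable [SigmaFinite νX]

/-- The function `x ↦ ∫ g(y | x') f(x' | x) φ(x') dx'` at the step from time `t` to time `t + 1`,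
written with the weights and the proposal. -/
noncomputable def predict (t : ℕ) (φ : X → ℝ) (x : X) : ℝ :=
  ∫ x', weightNext M Q y t x x' * φ x' ∂(moveKernel Q t x)

/-- The unnormalised filtering integral of `φ` at time `t`, that is, the integral of `φ` of the
last state against the joint density of the states and of the observations. -/
noncomputable def filterIntegral : ℕ → (X → ℝ) → ℝ
  | 0, φ => ∫ x, weightFirst M Q y x * φ x ∂(initialLaw Q)
  | t + 1, φ => filterIntegral t (predict M Q y t φ)

/-- The mean square error of the filter's estimate of the integral of `φ` at time `n`. -/
noncomputable def meanSquareError (n : ℕ) (R : ResamplingScheme N) (φ : X → ℝ) : ℝ≥0∞ :=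
  ∫⁻ ζ, ENNReal.ofReal ((filterEstimate M Q y ζ φ - filterIntegral M Q y n φ) ^ 2)
    ∂(systemLaw M Q y n R)

lemma measurable_predict (t : ℕ) {φ : X → ℝ} (hφ : Measurable φ) :
    Measurable (predict M Q y t φ) := by
  have : StronglyMeasurable fun p : X × X => weightNext M Q y t p.1 p.2 * φ p.2 :=
    ((measurable_weightNext M Q y t).mul (hφ.comp measurable_snd)).stronglyMeasurable
  exact (this.integral_kernel_prod_right' (κ := moveKernel Q t)).measurable

variable {M Q y}

omit [SigmaFinite νX] in
lemma abs_weightNext_mul_le {t : ℕ} {C B : ℝ} (h0 : ∀ x x', 0 < weightNext M Q y t x x')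
    (hC : ∀ x x', weightNext M Q y t x x' ≤ C) {φ : X → ℝ} (hB : ∀ x, |φ x| ≤ B) (x x' : X) :
    |weightNext M Q y t x x' * φ x'| ≤ C * B := by
  rw [abs_mul, abs_of_pos (h0 x x')]
  exact mul_le_mul (hC x x') (hB x') (abs_nonneg _) ((h0 x x').le.trans (hC x x'))

lemma abs_predict_le {t : ℕ} {C B : ℝ} (h0 : ∀ x x', 0 < weightNext M Q y t x x')
    (hC : ∀ x x', weightNext M Q y t x x' ≤ C) {φ : X → ℝ} (hB : ∀ x, |φ x| ≤ B) (x : X) :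
    |predict M Q y t φ x| ≤ C * B := by
  have := norm_integral_le_of_norm_le_const (μ := moveKernel Q t x)
    (f := fun x' => weightNext M Q y t x x' * φ x') (C := C * B)
    (ae_of_all _ fun x' => abs_weightNext_mul_le h0 hC hB x x')
  simpa [predict] using this

omit [SigmaFinite νX] in
lemma exists_likelihoodEstimate_le (h0 : ∀ x, 0 < weightFirst M Q y x)
    (h1 : ∀ t < n, ∀ x x', 0 < weightNext M Q y t x x')
    (hC0 : ∃ C : ℝ, ∀ x, weightFirst M Q y x ≤ C)
    (hC1 : ∀ t < n, ∃ C : ℝ, ∀ x x', weightNext M Q y t x x' ≤ C) :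
    ∃ K : ℝ, ∀ N, 1 ≤ N → ∀ ζ : ParticleSystem X n N, likelihoodEstimate M Q y ζ ≤ K := by
  have hC : ∀ t : Fin (n + 1), ∃ C : ℝ, ∀ (N : ℕ) (ζ : ParticleSystem X n N) (i : Fin N),
      particleWeight M Q y ζ t i ≤ C := by
    intro t
    induction t using Fin.cases with
    | zero =>
      obtain ⟨C, hC⟩ := hC0
      exact ⟨C, fun N ζ i => hC _⟩
    | succ k =>
      obtain ⟨C, hC⟩ := hC1 k k.2
      exact ⟨C, fun N ζ i => hC _ _⟩
  choose C hC using hC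
  refine ⟨∏ t, C t, fun N hN ζ => ?_⟩
  have hNpos : (0 : ℝ) < N := by exact_mod_cast hN
  refine Finset.prod_le_prod (fun t _ => ?_) fun t _ => ?_
  · exact mul_nonneg (by positivity) (sum_particleWeight_pos h0 h1 hN ζ t).le
  · rw [one_div, inv_mul_eq_div, div_le_iff₀ hNpos]
    refine (Finset.sum_le_sum fun i _ => hC t N ζ i).trans_eq ?_
    simp [mul_comm]

/-- The mean square error at time `n + 1` is bounded by the sampling noise of the moves, the
resampling noise, and the mean square error at time `n`. -/
lemma meanSquareError_succ_le (h0 : ∀ x, 0 < weightFirst M Q y x)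
    (h1 : ∀ t < n + 1, ∀ x x', 0 < weightNext M Q y t x x') {C : ℝ}
    (hC : ∀ x x', weightNext M Q y n x x' ≤ C) (hN : 1 ≤ N) {R : ResamplingScheme N}
    (hR : R.IsUnbiased) {K : ℝ} (hK : ∀ ζ : ParticleSystem X n N, likelihoodEstimate M Q y ζ ≤ K)
    {φ : X → ℝ} (hφ : Measurable φ) {B : ℝ} (hB : ∀ x, |φ x| ≤ B) :
    meanSquareError M Q y (n + 1) R φ ≤ ENNReal.ofReal (K ^ 2 * (C * B) ^ 2 / N) +
      ENNReal.ofReal (K ^ 2) * (∫⁻ ζ, ENNReal.ofReal (R.variance (normWeight M Q y ζ (Fin.last n))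
        fun i => predict M Q y n φ (ζ.1 (Fin.last n) i)) ∂(systemLaw M Q y n R)) +
      meanSquareError M Q y n R (predict M Q y n φ) := by
  have h1' : ∀ t < n, ∀ x x', 0 < weightNext M Q y t x x' := fun t ht => h1 t (by omega)
  have hnoise : Measurable fun ζ : ParticleSystem X n N => ENNReal.ofReal
      (R.variance (normWeight M Q y ζ (Fin.last n))
        fun i => predict M Q y n φ (ζ.1 (Fin.last n) i)) :=
    ENNReal.measurable_ofReal.comp (measurable_noise M Q y R _ (measurable_predict M Q y n hφ))
  have hmeas : Measurable fun ζ : ParticleSystem X (n + 1) N => ENNReal.ofReal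
      ((filterEstimate M Q y ζ φ - filterIntegral M Q y (n + 1) φ) ^ 2) :=
    ENNReal.measurable_ofReal.comp
      (((measurable_filterEstimate M Q y hφ).sub_const _).pow_const 2)
  have hpt : ∀ ζ : ParticleSystem X n N,
      ∑ a, ENNReal.ofReal (R.prob (normWeight M Q y ζ (Fin.last n)) a) *
        ∫⁻ x, ENNReal.ofReal
          ((filterEstimate M Q y (extend ζ a x) φ - filterIntegral M Q y (n + 1) φ) ^ 2)
          ∂(Measure.pi fun i => moveKernel Q n (ζ.1 (Fin.last n) (a i))) ≤
      ENNReal.ofReal (K ^ 2 * (C * B) ^ 2 / N) +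
        ENNReal.ofReal (K ^ 2) * ENNReal.ofReal (R.variance (normWeight M Q y ζ (Fin.last n))
          fun i => predict M Q y n φ (ζ.1 (Fin.last n) i)) +
        ENNReal.ofReal ((filterEstimate M Q y ζ (predict M Q y n φ) -
          filterIntegral M Q y n (predict M Q y n φ)) ^ 2) := by
    intro ζ
    set p := likelihoodEstimate M Q y ζ with hp
    set g := filterIntegral M Q y (n + 1) φ with hg
    set W := normWeight M Q y ζ (Fin.last n) with hWdef
    set ψ : Fin N → ℝ := fun i => predict M Q y n φ (ζ.1 (Fin.last n) i) with hψ
    have hp0 : 0 < p := likelihoodEstimate_pos h0 h1' hN ζ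
    have hpK : p ^ 2 ≤ K ^ 2 := pow_le_pow_left₀ hp0.le (hK ζ) 2
    have hW : W ∈ stdSimplex ℝ (Fin N) := normWeight_mem_stdSimplex h0 h1' hN ζ _
    -- Given the ancestors, the particles move independently.
    have hmove : ∀ a : Fin N → Fin N, ∫⁻ x, ENNReal.ofReal
          ((filterEstimate M Q y (extend ζ a x) φ - g) ^ 2)
          ∂(Measure.pi fun i => moveKernel Q n (ζ.1 (Fin.last n) (a i))) ≤
        ENNReal.ofReal (K ^ 2 * (C * B) ^ 2 / N + (p * ((1 / (N : ℝ)) * ∑ i, ψ (a i)) - g) ^ 2) := by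
      intro a
      simp_rw [filterEstimate_extend]
      refine (lintegral_pi_sq_average_le hN
        (fun i => moveKernel Q n (ζ.1 (Fin.last n) (a i)))
        (h := fun i x' => weightNext M Q y n (ζ.1 (Fin.last n) (a i)) x' * φ x')
        (fun i => ((measurable_weightNext M Q y n).comp measurable_prodMk_left).mul hφ)
        (fun i x' => abs_weightNext_mul_le (h1 n (by omega)) hC hB _ x') p g).trans ?_
      refine ENNReal.ofReal_le_ofReal ?_
      gcongr ?_ + ?_
      · gcongr
      · exact le_rfl
    have hnn : ∀ a : Fin N → Fin N,
        0 ≤ K ^ 2 * (C * B) ^ 2 / N + (p * ((1 / (N : ℝ)) * ∑ i, ψ (a i)) - g) ^ 2 :=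
      fun a => by positivity
    calc _ ≤ ∑ a, ENNReal.ofReal (R.prob W a) * ENNReal.ofReal (K ^ 2 * (C * B) ^ 2 / N +
            (p * ((1 / (N : ℝ)) * ∑ i, ψ (a i)) - g) ^ 2) :=
          Finset.sum_le_sum fun a _ => mul_le_mul_right (hmove a) _
      _ = ENNReal.ofReal (∑ a, R.prob W a * (K ^ 2 * (C * B) ^ 2 / N +
            (p * ((1 / (N : ℝ)) * ∑ i, ψ (a i)) - g) ^ 2)) := by
          rw [ENNReal.ofReal_sum_of_nonneg fun a _ => mul_nonneg (R.prob_nonneg _ _) (hnn a)]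
          exact Finset.sum_congr rfl fun a _ => (ENNReal.ofReal_mul (R.prob_nonneg _ _)).symm
      _ = ENNReal.ofReal (K ^ 2 * (C * B) ^ 2 / N + p ^ 2 * R.variance W ψ +
            (filterEstimate M Q y ζ (predict M Q y n φ) - g) ^ 2) := by
          -- Unbiasedness identifies the mean over the ancestors with the estimate at time `n`.
          congr 1
          simp_rw [mul_add]
          rw [Finset.sum_add_distrib, ← Finset.sum_mul, R.sum_prob, one_mul, R.sum_prob_mul_sq,
            hR.sum_prob_mul_average hN hW, filterEstimate_eq_likelihoodEstimate_mul M Q y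
              (sum_particleWeight_pos h0 h1' hN ζ _)]
          ring
      _ ≤ ENNReal.ofReal (K ^ 2 * (C * B) ^ 2 / N + K ^ 2 * R.variance W ψ +
            (filterEstimate M Q y ζ (predict M Q y n φ) - g) ^ 2) := by
          refine ENNReal.ofReal_le_ofReal ?_
          have := mul_le_mul_of_nonneg_right hpK (R.variance_nonneg W ψ)
          linarith
      _ = _ := by
          have hv := R.variance_nonneg W ψ
          rw [ENNReal.ofReal_add (by positivity) (by positivity),
            ENNReal.ofReal_add (by positivity) (by positivity),
            ENNReal.ofReal_mul (sq_nonneg K)]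
          rfl
  rw [meanSquareError, lintegral_systemLaw_succ M Q y R hmeas]
  refine (lintegral_mono hpt).trans_eq ?_
  have hsum : Measurable fun ζ : ParticleSystem X n N =>
      ENNReal.ofReal (K ^ 2 * (C * B) ^ 2 / N) + ENNReal.ofReal (K ^ 2) * ENNReal.ofReal
        (R.variance (normWeight M Q y ζ (Fin.last n))
          fun i => predict M Q y n φ (ζ.1 (Fin.last n) i)) :=
    measurable_const.add (hnoise.const_mul _)
  rw [lintegral_add_left hsum,
    lintegral_add_left measurable_const, lintegral_const, measure_univ, mul_one,
    lintegral_const_mul _ hnoise]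
  rfl

lemma meanSquareError_zero_le (h0 : ∀ x, 0 < weightFirst M Q y x) {C : ℝ}
    (hC : ∀ x, weightFirst M Q y x ≤ C) (hN : 1 ≤ N) (R : ResamplingScheme N)
    {φ : X → ℝ} (hφ : Measurable φ) {B : ℝ} (hB : ∀ x, |φ x| ≤ B) :
    meanSquareError M Q y 0 R φ ≤ ENNReal.ofReal ((C * B) ^ 2 / N) := by
  have hmeas : Measurable fun ζ : ParticleSystem X 0 N => ENNReal.ofReal
      ((filterEstimate M Q y ζ φ - filterIntegral M Q y 0 φ) ^ 2) :=
    ENNReal.measurable_ofReal.comp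
      (((measurable_filterEstimate M Q y hφ).sub_const _).pow_const 2)
  have hNpos : (N : ℝ) ≠ 0 := by exact_mod_cast (by omega : N ≠ 0)
  rw [meanSquareError, lintegral_systemLaw_zero M Q y R hmeas]
  have hest : ∀ x : Fin N → X, filterEstimate M Q y
      ((fun _ => x, Fin.elim0) : ParticleSystem X 0 N) φ =
      1 * ((1 / (N : ℝ)) * ∑ i, weightFirst M Q y (x i) * φ (x i)) := by
    intro x
    simp only [filterEstimate, Finset.univ_eq_empty, Finset.prod_empty]
    rfl
  simp_rw [hest]
  refine (lintegral_pi_sq_average_le hN (fun _ => initialLaw Q)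
    (h := fun _ x => weightFirst M Q y x * φ x)
    (fun _ => (measurable_weightFirst M Q y).mul hφ) (B := C * B) (fun _ x => ?_) 1 _).trans_eq ?_
  · rw [abs_mul, abs_of_pos (h0 x)]
    exact mul_le_mul (hC x) (hB x) (abs_nonneg _) ((h0 x).le.trans (hC x))
  · congr 1
    have : 1 * (1 / (N : ℝ) * ∑ _i : Fin N, ∫ x, weightFirst M Q y x * φ x ∂(initialLaw Q)) -
        filterIntegral M Q y 0 φ = 0 := by
      rw [filterIntegral, Finset.sum_const, Finset.card_univ, Fintype.card_fin, nsmul_eq_mul]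
      field_simp
      ring
    rw [this]
    ring

/-- The resampling noise at time `t` does not depend on how long the filter is run. -/
lemma lintegral_noise_eq (R : ResamplingScheme N) {φ : X → ℝ} (hφ : Measurable φ)
    (t : Fin (n + 1)) :
    ∫⁻ ζ, ENNReal.ofReal (R.variance (normWeight M Q y ζ t) fun i => φ (ζ.1 t i))
        ∂(systemLaw M Q y n R) =
      ∫⁻ ζ, ENNReal.ofReal (R.variance (normWeight M Q y ζ (Fin.last t))
        fun i => φ (ζ.1 (Fin.last t) i)) ∂(systemLaw M Q y t R) := by
  induction n with
  | zero =>
    obtain rfl : t = Fin.last 0 := Subsingleton.elim (α := Fin 1) _ _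
    rfl
  | succ n ih =>
    induction t using Fin.lastCases with
    | last => rfl
    | cast t =>
      refine Eq.trans ?_ (ih t)
      refine lintegral_systemLaw_succ_of_extend M Q y R
        (ENNReal.measurable_ofReal.comp (measurable_noise M Q y R _ hφ)) fun ζ a x => ?_
      rw [Function.comp_apply, normWeight_extend_castSucc, extend_fst_castSucc]

lemma VanishingResamplingNoise.tendsto_lintegral {R : ∀ N, ResamplingScheme N}
    (hV : VanishingResamplingNoise M Q y n R) {t : ℕ} (ht : t < n) {φ : X → ℝ}
    (hφ : Measurable φ) {B : ℝ} (hB : ∀ x, |φ x| ≤ B) :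
    Tendsto (fun N => ∫⁻ ζ, ENNReal.ofReal ((R N).variance (normWeight M Q y ζ (Fin.last t))
      fun i => φ (ζ.1 (Fin.last t) i)) ∂(systemLaw M Q y t (R N))) atTop (𝓝 0) := by
  have h := ENNReal.tendsto_ofReal (hV ⟨t, ht⟩ φ hφ ⟨B, hB⟩)
  rw [ENNReal.ofReal_zero] at h
  refine h.congr' ?_
  filter_upwards [eventually_ge_atTop 1] with N hN
  rw [ofReal_integral_eq_lintegral_ofReal]
  · exact lintegral_noise_eq (R N) hφ (Fin.castSucc ⟨t, ht⟩)
  · refine Integrable.of_bound (C := B ^ 2)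
      (measurable_noise M Q y (R N) _ hφ).aestronglyMeasurable (ae_of_all _ fun ζ => ?_)
    rw [Real.norm_of_nonneg ((R N).variance_nonneg _ _)]
    exact (R N).variance_le (fun i => hB _) hN _
  · exact ae_of_all _ fun ζ => (R N).variance_nonneg _ _

lemma tendsto_ofReal_div_natCast (c : ℝ) :
    Tendsto (fun N : ℕ => ENNReal.ofReal (c / N)) atTop (𝓝 0) := by
  have := ENNReal.tendsto_ofReal (tendsto_const_div_atTop_nhds_zero_nat c)
  rwa [ENNReal.ofReal_zero] at this

/-- With bounded weights, unbiased resampling and vanishing resampling noise, the filter's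
estimates converge in mean square at all times. -/
lemma tendsto_meanSquareError (h0 : ∀ x, 0 < weightFirst M Q y x)
    (h1 : ∀ t < n, ∀ x x', 0 < weightNext M Q y t x x')
    (hC0 : ∃ C : ℝ, ∀ x, weightFirst M Q y x ≤ C)
    (hC1 : ∀ t < n, ∃ C : ℝ, ∀ x x', weightNext M Q y t x x' ≤ C)
    {R : ∀ N, ResamplingScheme N} (hR : ∀ N, 1 ≤ N → (R N).IsUnbiased)
    (hV : VanishingResamplingNoise M Q y n R) {t : ℕ} (ht : t ≤ n) {φ : X → ℝ}
    (hφ : Measurable φ) {B : ℝ} (hB : ∀ x, |φ x| ≤ B) :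
    Tendsto (fun N => meanSquareError M Q y t (R N) φ) atTop (𝓝 0) := by
  induction t generalizing φ B with
  | zero =>
    obtain ⟨C, hC⟩ := hC0
    refine tendsto_of_tendsto_of_tendsto_of_le_of_le' tendsto_const_nhds
      (tendsto_ofReal_div_natCast ((C * B) ^ 2)) (Eventually.of_forall fun _ => bot_le) ?_
    filter_upwards [eventually_ge_atTop 1] with N hN
    exact meanSquareError_zero_le h0 hC hN (R N) hφ hB
  | succ t ih =>
    have ht' : t < n := ht
    obtain ⟨C, hC⟩ := hC1 t ht'
    obtain ⟨K, hK⟩ := exists_likelihoodEstimate_le (n := t) h0 (fun s hs => h1 s (by omega)) hC0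
      fun s hs => hC1 s (by omega)
    have hψ := measurable_predict M Q y t hφ
    have hψB := abs_predict_le (h1 t ht') hC hB
    have hlim := ((tendsto_ofReal_div_natCast (K ^ 2 * (C * B) ^ 2)).add
      (ENNReal.Tendsto.const_mul (a := ENNReal.ofReal (K ^ 2)) (hV.tendsto_lintegral ht' hψ hψB)
        (Or.inr ENNReal.ofReal_ne_top))).add (ih ht'.le hψ hψB)
    simp only [mul_zero, add_zero] at hlim
    refine tendsto_of_tendsto_of_tendsto_of_le_of_le' tendsto_const_nhds hlim
      (Eventually.of_forall fun _ => bot_le) ?_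
    filter_upwards [eventually_ge_atTop 1] with N hN
    exact meanSquareError_succ_le h0 (fun s hs => h1 s (by omega)) hC hN (hR N hN) (hK N hN) hφ hB

end Convergence

end CoupledPIMH

namespace CoupledPIMH

/-! ### The likelihood -/

section Likelihood

variable {X Y : Type*} [MeasurableSpace X] [MeasurableSpace Y]
  {νX : Measure X} {νY : Measure Y}
  {M : StateSpaceModel νX νY} {Q : Proposals νX} {y : ℕ → Y} {n : ℕ}

/-- The division in the weight is a true one: a zero of the proposal density would give the weight
`0`. -/
lemma weightFirst_mul_first (h0 : ∀ x, 0 < weightFirst M Q y x) (x : X) :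
    weightFirst M Q y x * Q.first x = M.init x * M.obs x (y 0) := by
  have hne : Q.first x ≠ 0 := fun h => by
    have := h0 x
    rw [weightFirst, h, div_zero] at this
    exact lt_irrefl _ this
  rw [weightFirst, div_mul_cancel₀ _ hne, mul_comm]

lemma weightNext_mul_next {t : ℕ} (h1 : ∀ x x', 0 < weightNext M Q y t x x') (x x' : X) :
    weightNext M Q y t x x' * Q.next t x x' = M.trans x x' * M.obs x' (y (t + 1)) := by
  have hne : Q.next t x x' ≠ 0 := fun h => by
    have := h1 x x'
    rw [weightNext, h, div_zero] at this
    exact lt_irrefl _ this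
  rw [weightNext, div_mul_cancel₀ _ hne, mul_comm]

lemma init_mul_obs_pos (h0 : ∀ x, 0 < weightFirst M Q y x) (x : X) :
    0 < M.init x * M.obs x (y 0) := by
  rw [← weightFirst_mul_first h0 x]
  refine mul_pos (h0 x) (lt_of_le_of_ne (Q.isDensity_first.2.1 x) fun h => ?_)
  have := h0 x
  rw [weightFirst, ← h, div_zero] at this
  exact lt_irrefl _ this

lemma trans_mul_obs_pos {t : ℕ} (h1 : ∀ x x', 0 < weightNext M Q y t x x') (x x' : X) :
    0 < M.trans x x' * M.obs x' (y (t + 1)) := by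
  rw [← weightNext_mul_next h1 x x']
  refine mul_pos (h1 x x') (lt_of_le_of_ne ((Q.isTransitionDensity_next t).2.1 x x') fun h => ?_)
  have := h1 x x'
  rw [weightNext, ← h, div_zero] at this
  exact lt_irrefl _ this

lemma jointDensity_pos (h0 : ∀ x, 0 < weightFirst M Q y x)
    (h1 : ∀ t < n, ∀ x x', 0 < weightNext M Q y t x x') (x : Fin (n + 1) → X) :
    0 < jointDensity M y n x :=
  mul_pos (init_mul_obs_pos h0 _) (Finset.prod_pos fun k _ => trans_mul_obs_pos (h1 k k.2) _ _)

lemma jointDensity_snoc (xs : Fin (n + 1) → X) (x : X) :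
    jointDensity M y (n + 1) (Fin.snoc (α := fun _ => X) xs x) =
      jointDensity M y n xs * (M.trans (xs (Fin.last n)) x * M.obs x (y (n + 1))) := by
  have h0 : Fin.snoc (α := fun _ => X) xs x 0 = xs 0 := by
    rw [← Fin.castSucc_zero, Fin.snoc_castSucc]
  unfold jointDensity
  rw [Fin.prod_univ_castSucc, h0]
  simp only [Fin.snoc_castSucc, Fin.succ_castSucc, Fin.succ_last, Fin.snoc_last, Fin.val_castSucc,
    Fin.val_last]
  ring

lemma measurable_obs (t : ℕ) : Measurable fun x => M.obs x (y t) :=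
  M.isTransitionDensity_obs.1.comp measurable_prodMk_right

lemma measurable_jointDensity : Measurable (jointDensity M y n) := by
  have hi := M.isDensity_init.1
  refine Measurable.mul ((hi.comp (measurable_pi_apply _)).mul
    ((measurable_obs 0).comp (measurable_pi_apply _))) (Finset.measurable_prod _ fun k _ => ?_)
  exact (M.isTransitionDensity_trans.1.comp
    (f := fun x : Fin (n + 1) → X => (x k.castSucc, x k.succ)) (by fun_prop)).mul
      ((measurable_obs _).comp (measurable_pi_apply _))

variable [SigmaFinite νX]

lemma likelihood_pos (h0 : ∀ x, 0 < weightFirst M Q y x)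
    (h1 : ∀ t < n, ∀ x x', 0 < weightNext M Q y t x x')
    (hint : Integrable (jointDensity M y n) (Measure.pi fun _ : Fin (n + 1) => νX)) :
    0 < likelihood M y n := by
  rw [likelihood, integral_pos_iff_support_of_nonneg (fun x => (jointDensity_pos h0 h1 x).le) hint]
  have hsupp : Function.support (jointDensity M y n) = Set.univ :=
    Set.eq_univ_of_forall fun x => (jointDensity_pos h0 h1 x).ne'
  have hν : νX Set.univ ≠ 0 := by
    intro h
    have := M.isDensity_init.2.2
    rw [← setLIntegral_univ, setLIntegral_measure_zero _ _ h] at this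
    exact zero_ne_one this
  rw [hsupp, Measure.pi_univ, pos_iff_ne_zero]
  exact Finset.prod_ne_zero_iff.2 fun _ _ => hν

/-- For a nonnegative function, the recursion over the proposals computes the integral against the
joint density. -/
lemma ofReal_filterIntegral (h0 : ∀ x, 0 < weightFirst M Q y x)
    (hC0 : ∃ C : ℝ, ∀ x, weightFirst M Q y x ≤ C)
    (h1 : ∀ t < n, ∀ x x', 0 < weightNext M Q y t x x')
    (hC1 : ∀ t < n, ∃ C : ℝ, ∀ x x', weightNext M Q y t x x' ≤ C)
    {φ : X → ℝ} (hφ : Measurable φ) (hφ0 : ∀ x, 0 ≤ φ x) {B : ℝ} (hB : ∀ x, |φ x| ≤ B) :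
    0 ≤ filterIntegral M Q y n φ ∧ ENNReal.ofReal (filterIntegral M Q y n φ) =
      ∫⁻ x, ENNReal.ofReal (jointDensity M y n x) * ENNReal.ofReal (φ (x (Fin.last n)))
        ∂(Measure.pi fun _ : Fin (n + 1) => νX) := by
  have hjφ : ∀ (m : ℕ) {φ : X → ℝ}, Measurable φ → Measurable fun x : Fin (m + 1) → X =>
      ENNReal.ofReal (jointDensity M y m x) * ENNReal.ofReal (φ (x (Fin.last m))) :=
    fun m φ hφ => (ENNReal.measurable_ofReal.comp measurable_jointDensity).mul
      (ENNReal.measurable_ofReal.comp (hφ.comp (measurable_pi_apply _)))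
  induction n generalizing φ B with
  | zero =>
    obtain ⟨C, hC⟩ := hC0
    have hw := measurable_weightFirst M Q y
    have hnn : ∀ x, 0 ≤ weightFirst M Q y x * φ x := fun x => mul_nonneg (h0 x).le (hφ0 x)
    refine ⟨integral_nonneg hnn, ?_⟩
    have hwφ : Measurable fun x => ENNReal.ofReal (weightFirst M Q y x * φ x) :=
      ENNReal.measurable_ofReal.comp (hw.mul hφ)
    have hq : Measurable fun x => ENNReal.ofReal (Q.first x) :=
      ENNReal.measurable_ofReal.comp Q.isDensity_first.1
    rw [filterIntegral, ofReal_integral_eq_lintegral_ofReal _ (ae_of_all _ hnn), initialLaw,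
      lintegral_withDensity_eq_lintegral_mul _ hq hwφ, lintegral_pi_snoc _ (hjφ 0 hφ)]
    · have hx : ∀ (xs : Fin 0 → X) (x : X),
          Fin.snoc (n := 0) (α := fun _ => X) xs x = fun _ => x := by
        intro xs x
        funext t
        have ht : t = Fin.last 0 := Subsingleton.elim (α := Fin 1) _ _
        rw [ht, Fin.snoc_last]
      simp only [hx, lintegral_const, Measure.pi_empty_univ, mul_one]
      refine lintegral_congr fun x => ?_
      rw [Pi.mul_apply, ← ENNReal.ofReal_mul (Q.isDensity_first.2.1 x), ← mul_assoc,
        mul_comm (Q.first x), weightFirst_mul_first h0,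
        ENNReal.ofReal_mul (init_mul_obs_pos h0 x).le]
      simp [jointDensity]
    · refine Integrable.of_bound (C := C * B) (hw.mul hφ).aestronglyMeasurable
        (ae_of_all _ fun x => ?_)
      rw [Real.norm_eq_abs, abs_mul, abs_of_pos (h0 x)]
      exact mul_le_mul (hC x) (hB x) (abs_nonneg _) ((h0 x).le.trans (hC x))
  | succ n ih =>
    obtain ⟨C, hC⟩ := hC1 n (by omega)
    have hpos := h1 n (by omega)
    have hnn : ∀ x x', 0 ≤ weightNext M Q y n x x' * φ x' := fun x x' =>
      mul_nonneg (hpos x x').le (hφ0 x')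
    have hψm := measurable_predict M Q y n hφ
    obtain ⟨ih0, ih1⟩ := ih (fun t ht => h1 t (by omega)) (fun t ht => hC1 t (by omega)) hψm
      (fun x => integral_nonneg (hnn x)) (abs_predict_le hpos hC hB)
    refine ⟨ih0, ?_⟩
    have hwm : ∀ x, Measurable fun x' => weightNext M Q y n x x' * φ x' := fun x =>
      ((measurable_weightNext M Q y n).comp measurable_prodMk_left).mul hφ
    have htm : ∀ x, Measurable fun x' =>
        ENNReal.ofReal (M.trans x x' * M.obs x' (y (n + 1))) * ENNReal.ofReal (φ x') := fun x =>
      (ENNReal.measurable_ofReal.comp ((M.isTransitionDensity_trans.1.comp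
        measurable_prodMk_left).mul (measurable_obs _))).mul
          (ENNReal.measurable_ofReal.comp hφ)
    have hpred : ∀ x, ENNReal.ofReal (predict M Q y n φ x) =
        ∫⁻ x', ENNReal.ofReal (M.trans x x' * M.obs x' (y (n + 1))) * ENNReal.ofReal (φ x')
          ∂νX := by
      intro x
      have hwo : Measurable fun x' => ENNReal.ofReal (weightNext M Q y n x x' * φ x') :=
        ENNReal.measurable_ofReal.comp (hwm x)
      have hq : Measurable fun x' => ENNReal.ofReal (Q.next n x x') :=
        (measurable_ofReal_next Q n).comp measurable_prodMk_left
      rw [predict, ofReal_integral_eq_lintegral_ofReal _ (ae_of_all _ (hnn x)), moveKernel_apply,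
        lintegral_withDensity_eq_lintegral_mul _ hq hwo]
      · refine lintegral_congr fun x' => ?_
        rw [Pi.mul_apply, ← ENNReal.ofReal_mul ((Q.isTransitionDensity_next n).2.1 x x'),
          ← mul_assoc, mul_comm (Q.next n x x'), weightNext_mul_next hpos,
          ENNReal.ofReal_mul (trans_mul_obs_pos hpos x x').le]
      · exact Integrable.of_bound (C := C * B) (hwm x).aestronglyMeasurable
          (ae_of_all _ fun x' => abs_weightNext_mul_le hpos hC hB x x')
    rw [filterIntegral, ih1,
      lintegral_pi_snoc _ (hjφ (n + 1) hφ)]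
    refine lintegral_congr fun xs => ?_
    rw [hpred, ← lintegral_const_mul _ (htm _)]
    refine lintegral_congr fun x => ?_
    rw [jointDensity_snoc, Fin.snoc_last, ENNReal.ofReal_mul
      (jointDensity_pos h0 (fun t ht => h1 t (by omega)) xs).le, mul_assoc]

lemma filterIntegral_one (h0 : ∀ x, 0 < weightFirst M Q y x)
    (hC0 : ∃ C : ℝ, ∀ x, weightFirst M Q y x ≤ C)
    (h1 : ∀ t < n, ∀ x x', 0 < weightNext M Q y t x x')
    (hC1 : ∀ t < n, ∃ C : ℝ, ∀ x x', weightNext M Q y t x x' ≤ C) :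
    filterIntegral M Q y n (fun _ => 1) = likelihood M y n := by
  obtain ⟨hnn, h⟩ := ofReal_filterIntegral h0 hC0 h1 hC1 (φ := fun _ => 1) measurable_const
    (fun _ => zero_le_one) (B := 1) (fun _ => by simp)
  rw [likelihood, integral_eq_lintegral_of_nonneg_ae
    (ae_of_all _ fun x => (jointDensity_pos h0 h1 x).le)
    measurable_jointDensity.aestronglyMeasurable]
  simp only [ENNReal.ofReal_one, mul_one] at h
  rw [← h, ENNReal.toReal_ofReal hnn]

end Likelihood

/-! ### The output of the particle filter -/

section Output

variable {X Y : Type*} [MeasurableSpace X] [MeasurableSpace Y]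
  {νX : Measure X} {νY : Measure Y}
  {M : StateSpaceModel νX νY} {Q : Proposals νX} {y : ℕ → Y} {n N : ℕ}

lemma measurable_output : Measurable fun s : Fin N × ParticleSystem X n N =>
    (trajectory s.2 s.1, likelihoodEstimate M Q y s.2) := by
  refine Measurable.prodMk (measurable_pi_lambda _ fun t => ?_)
    ((measurable_likelihoodEstimate M Q y).comp measurable_snd)
  have h1 : Measurable fun p : (Fin n → Fin N → Fin N) × Fin N => lineage p.1 p.2 t :=
    measurable_of_countable _
  have h2 : Measurable fun p : (Fin N → X) × Fin N => p.1 p.2 :=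
    measurable_from_prod_countable_left fun j => measurable_pi_apply j
  exact h2.comp (f := fun s : Fin N × ParticleSystem X n N => (s.2.1 t, lineage s.2.2 s.1 t))
    (Measurable.prodMk (by fun_prop)
      (h1.comp (f := fun s : Fin N × ParticleSystem X n N => (s.2.2, s.1)) (by fun_prop)))

lemma ae_filterLaw_pos (h0 : ∀ x, 0 < weightFirst M Q y x)
    (h1 : ∀ t < n, ∀ x x', 0 < weightNext M Q y t x x') (hN : 1 ≤ N) (R : ResamplingScheme N) :
    ∀ᵐ s ∂(filterLaw M Q y n R), 0 < s.2 := by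
  rw [filterLaw, ae_map_iff measurable_output.aemeasurable
    (measurableSet_lt measurable_const measurable_snd)]
  exact ae_of_all _ fun s => likelihoodEstimate_pos h0 h1 hN s.2

lemma measurable_logError : Measurable (logError M y n) := by
  unfold logError
  fun_prop

variable [SigmaFinite νX]

/-- The likelihood estimate has the same law under the law of the output as under the law of the
particle system: the terminal index is drawn from a probability distribution. -/
lemma filterLaw_preimage_snd (h0 : ∀ x, 0 < weightFirst M Q y x)
    (h1 : ∀ t < n, ∀ x x', 0 < weightNext M Q y t x x') (hN : 1 ≤ N) (R : ResamplingScheme N)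
    {S : Set ℝ} (hS : MeasurableSet S) :
    filterLaw M Q y n R (Prod.snd ⁻¹' S) =
      systemLaw M Q y n R {ζ | likelihoodEstimate M Q y ζ ∈ S} := by
  have hS' : MeasurableSet {ζ : ParticleSystem X n N | likelihoodEstimate M Q y ζ ∈ S} :=
    measurable_likelihoodEstimate M Q y hS
  have hW : Measurable fun s : Fin N × ParticleSystem X n N =>
      normWeight M Q y s.2 (Fin.last n) s.1 :=
    measurable_from_prod_countable_right fun j =>
      (measurable_pi_apply j).comp (measurable_normWeight M Q y (Fin.last n))
  have hdens : Measurable fun s : Fin N × ParticleSystem X n N => ENNReal.ofReal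
      (filterDensity M Q y R s.2 * normWeight M Q y s.2 (Fin.last n) s.1) :=
    ENNReal.measurable_ofReal.comp
      (((measurable_filterDensity M Q y R).comp measurable_snd).mul hW)
  have hset : (fun s : Fin N × ParticleSystem X n N =>
      (trajectory s.2 s.1, likelihoodEstimate M Q y s.2)) ⁻¹' (Prod.snd ⁻¹' S) =
        Prod.snd ⁻¹' {ζ : ParticleSystem X n N | likelihoodEstimate M Q y ζ ∈ S} := rfl
  have hsf : SFinite (systemMeasure νX n N) := by
    unfold systemMeasure
    infer_instance
  rw [filterLaw, Measure.map_apply measurable_output (measurable_snd hS), hset, indexedSystemLaw,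
    withDensity_apply _ (measurable_snd hS'), ← lintegral_indicator (measurable_snd hS'),
    lintegral_prod_symm _ (hdens.indicator (measurable_snd hS')).aemeasurable, systemLaw,
    withDensity_apply _ hS', ← lintegral_indicator hS']
  refine lintegral_congr fun ζ => ?_
  rw [lintegral_count, tsum_fintype]
  obtain ⟨hW0, hW1⟩ := normWeight_mem_stdSimplex h0 h1 hN ζ (Fin.last n)
  by_cases hζ : ζ ∈ {ζ : ParticleSystem X n N | likelihoodEstimate M Q y ζ ∈ S}
  · rw [Set.indicator_of_mem hζ]
    have hj : ∀ j : Fin N, (j, ζ) ∈ (Prod.snd ⁻¹'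
        {ζ : ParticleSystem X n N | likelihoodEstimate M Q y ζ ∈ S} :
          Set (Fin N × ParticleSystem X n N)) := fun j => hζ
    rw [Finset.sum_congr rfl fun j _ => Set.indicator_of_mem (hj j) _,
      ← ENNReal.ofReal_sum_of_nonneg fun j _ =>
      mul_nonneg (filterDensity_nonneg M Q y R ζ) (hW0 j), ← Finset.mul_sum, hW1, mul_one]
  · rw [Set.indicator_of_notMem hζ]
    have hj : ∀ j : Fin N, (j, ζ) ∉ (Prod.snd ⁻¹'
        {ζ : ParticleSystem X n N | likelihoodEstimate M Q y ζ ∈ S} :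
          Set (Fin N × ParticleSystem X n N)) := fun j => hζ
    exact Finset.sum_eq_zero fun j _ => Set.indicator_of_notMem (hj j) _

/-- The likelihood estimator is consistent. -/
lemma tendsto_filterLaw_deviation (h0 : ∀ x, 0 < weightFirst M Q y x)
    (h1 : ∀ t < n, ∀ x x', 0 < weightNext M Q y t x x')
    (hC0 : ∃ C : ℝ, ∀ x, weightFirst M Q y x ≤ C)
    (hC1 : ∀ t < n, ∃ C : ℝ, ∀ x x', weightNext M Q y t x x' ≤ C)
    {R : ∀ N, ResamplingScheme N} (hR : ∀ N, 1 ≤ N → (R N).IsUnbiased)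
    (hV : VanishingResamplingNoise M Q y n R) {ε : ℝ} (hε : 0 < ε) :
    Tendsto (fun N => filterLaw M Q y n (R N) {s | ε ≤ |s.2 - likelihood M y n|})
      atTop (𝓝 0) := by
  have hmse := tendsto_meanSquareError h0 h1 hC0 hC1 hR hV le_rfl (φ := fun _ => 1)
    measurable_const (B := 1) (fun _ => by simp)
  have hε2 : ENNReal.ofReal (ε ^ 2) ≠ 0 := by
    rw [Ne, ENNReal.ofReal_eq_zero, not_le]
    positivity
  have hlim := ENNReal.Tendsto.div_const hmse (b := ENNReal.ofReal (ε ^ 2)) (Or.inr hε2)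
  rw [ENNReal.zero_div] at hlim
  refine tendsto_of_tendsto_of_tendsto_of_le_of_le' tendsto_const_nhds hlim
    (Eventually.of_forall fun _ => bot_le) ?_
  filter_upwards [eventually_ge_atTop 1] with N hN
  have hS : MeasurableSet {p : ℝ | ε ≤ |p - likelihood M y n|} :=
    measurableSet_le (by fun_prop) (by fun_prop)
  refine (filterLaw_preimage_snd h0 h1 hN (R N) hS).trans_le ?_
  have hm : Measurable fun ζ : ParticleSystem X n N => ENNReal.ofReal
      ((filterEstimate M Q y ζ (fun _ => 1) - filterIntegral M Q y n (fun _ => 1)) ^ 2) :=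
    ENNReal.measurable_ofReal.comp
      (((measurable_filterEstimate M Q y measurable_const).sub_const _).pow_const 2)
  refine le_trans (measure_mono fun ζ hζ => ?_)
    (meas_ge_le_lintegral_div hm.aemeasurable hε2 ENNReal.ofReal_ne_top)
  refine ENNReal.ofReal_le_ofReal ?_
  rw [filterEstimate_one, filterIntegral_one h0 hC0 h1 hC1, ← sq_abs (_ - _)]
  exact pow_le_pow_left₀ hε.le hζ 2

end Output

section AcceptanceLimit

/-- Consistency of the estimates makes the first proposal accepted with high probability. -/
lemma tendsto_measure_accept {E : Type*} [MeasurableSpace E] {L : ℕ → Measure (E × ℝ)}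
    {Ω : ℕ → Type*} [∀ N, MeasurableSpace (Ω N)] {P : ∀ N, Measure (Ω N)}
    [∀ N, IsProbabilityMeasure (P N)] {ξ : ∀ N, ℕ → Ω N → E × ℝ} {u : ∀ N, ℕ → Ω N → ℝ}
    (input : ∀ N, 1 ≤ N → IsRandomInput (L N) (P N) (ξ N) (u N)) {c : ℝ} (hc : 0 < c)
    (hL : ∀ ε : ℝ, 0 < ε → Tendsto (fun N => L N {s | ε ≤ |s.2 - c|}) atTop (𝓝 0)) :
    Tendsto (fun N => P N {ω | u N 1 ω ≤ acceptProb (ξ N 0 ω).2 (ξ N 1 ω).2}) atTop (𝓝 1) := by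
  have hcompl : Tendsto (fun N => P N {ω | u N 1 ω ≤ acceptProb (ξ N 0 ω).2 (ξ N 1 ω).2}ᶜ)
      atTop (𝓝 0) := by
    rw [ENNReal.tendsto_nhds_zero]
    intro ε hε
    have hδlim : Tendsto (fun δ : ℝ => ENNReal.ofReal δ) (𝓝[>] 0) (𝓝 0) := by
      have := (ENNReal.continuous_ofReal.tendsto 0).mono_left
        (nhdsWithin_le_nhds (s := Set.Ioi (0 : ℝ)))
      rwa [ENNReal.ofReal_zero] at this
    obtain ⟨δ, hδε, hδ0, hδ1⟩ := ((hδlim.eventually_lt_const hε).and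
      (Ioo_mem_nhdsGT (zero_lt_one' ℝ))).exists
    have hlim := (ENNReal.Tendsto.const_mul (a := 2) (hL (c * (δ / 2)) (by positivity))
      (Or.inr (by simp))).const_add (ENNReal.ofReal δ)
    rw [mul_zero, add_zero] at hlim
    filter_upwards [eventually_ge_atTop 1, hlim.eventually_lt_const hδε] with N hN hlt
    exact ((input N hN).measure_reject_le hc hδ0 hδ1).trans hlt.le
  have hsub := ENNReal.Tendsto.sub tendsto_const_nhds hcompl (a := 1) (Or.inl ENNReal.one_ne_top)
  rw [tsub_zero] at hsub
  refine hsub.congr' ?_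
  filter_upwards [eventually_ge_atTop 1] with N hN
  have hm : MeasurableSet {ω | u N 1 ω ≤ acceptProb (ξ N 0 ω).2 (ξ N 1 ω).2} := by
    have h0 := (input N hN).measurable_proposal 0
    have h1 := (input N hN).measurable_proposal 1
    have hu := (input N hN).measurable_uniform 1
    unfold acceptProb
    exact measurableSet_le hu (measurable_const.min (h1.snd.div h0.snd))
  rw [← prob_compl_eq_one_sub hm.compl, compl_compl]

end AcceptanceLimit

end CoupledPIMH

theorem mainTheorem2 {X Y : Type*} [MeasurableSpace X] [MeasurableSpace Y]
    (νX : Measure X) (νY : Measure Y) [SigmaFinite νX] [SigmaFinite νY]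
    (M : CoupledPIMH.StateSpaceModel νX νY) (Q : CoupledPIMH.Proposals νX) (y : ℕ → Y) (n : ℕ)
    (R : ∀ N : ℕ, CoupledPIMH.ResamplingScheme N)
    (weightFirst_pos : ∀ x, 0 < CoupledPIMH.weightFirst M Q y x)
    (weightNext_pos : ∀ t < n, ∀ x x', 0 < CoupledPIMH.weightNext M Q y t x x')
    (likelihood_finite : Integrable (CoupledPIMH.jointDensity M y n)
      (Measure.pi fun _ : Fin (n + 1) => νX))
    {Ω : ℕ → Type*} [∀ N, MeasurableSpace (Ω N)]
    (P : ∀ N, Measure (Ω N)) [∀ N, IsProbabilityMeasure (P N)]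
    (ξ : ∀ N, ℕ → Ω N → (Fin (n + 1) → X) × ℝ) (u : ∀ N, ℕ → Ω N → ℝ)
    (input : ∀ N, 1 ≤ N →
      CoupledPIMH.IsRandomInput (CoupledPIMH.filterLaw M Q y n (R N)) (P N) (ξ N) (u N))
    (τ : ∀ N, Ω N → ℕ∞)
    (hτ : ∀ N ω, τ N ω = CoupledPIMH.meetingTime (fun k => ξ N k ω) (fun k => u N k ω))
    (Z₀ : ∀ N, Ω N → ℝ) (hZ₀ : ∀ N ω, Z₀ N ω = CoupledPIMH.logError M y n (ξ N 0 ω)) :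
    (∀ N, 1 ≤ N →
      (∀ z, 0 < CoupledPIMH.avgAcceptance M Q y n (R N) z ∧
        CoupledPIMH.avgAcceptance M Q y n (R N) z ≤ 1) ∧
      (∀ᵐ z ∂((P N).map (Z₀ N)), condDistrib (τ N) (Z₀ N) (P N) z =
        CoupledPIMH.geometricLaw (CoupledPIMH.avgAcceptance M Q y n (R N) z)) ∧
      1 / 2 ≤ P N {ω | τ N ω = 1}) ∧
    ((∀ N, 1 ≤ N → (R N).IsUnbiased) →
      (∃ C : ℝ, ∀ x, CoupledPIMH.weightFirst M Q y x ≤ C) →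
      (∀ t < n, ∃ C : ℝ, ∀ x x', CoupledPIMH.weightNext M Q y t x x' ≤ C) →
      CoupledPIMH.VanishingResamplingNoise M Q y n R →
      Tendsto (fun N => P N {ω | τ N ω = 1}) atTop (𝓝 1)) := by
  have hp : 0 < CoupledPIMH.likelihood M y n :=
    CoupledPIMH.likelihood_pos weightFirst_pos weightNext_pos likelihood_finite
  have hone : ∀ N, {ω | τ N ω = 1} =
      {ω | u N 1 ω ≤ CoupledPIMH.acceptProb (ξ N 0 ω).2 (ξ N 1 ω).2} := by
    intro N
    ext ω
    change τ N ω = 1 ↔ _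
    rw [hτ, CoupledPIMH.meetingTime_eq_one_iff]
    rfl
  simp_rw [hone]
  refine ⟨fun N hN => ?_, fun hR hC0 hC1 hV => ?_⟩
  · have hin := input N hN
    have hpos := CoupledPIMH.ae_filterLaw_pos weightFirst_pos weightNext_pos hN (R N)
    have hℓ : Measurable (CoupledPIMH.logError M y n) := CoupledPIMH.measurable_logError
    have hprob := hin.isProbabilityMeasure
    refine ⟨fun z => ?_, ?_, hin.half_le_measure_accept hpos⟩
    · have := Measure.isProbabilityMeasure_map (μ := CoupledPIMH.filterLaw M Q y n (R N))
        hℓ.aemeasurable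
      exact CoupledPIMH.avg_min_one_exp_mem
        ((CoupledPIMH.filterLaw M Q y n (R N)).map (CoupledPIMH.logError M y n)) z
    · have hZ : Z₀ N = fun ω => CoupledPIMH.logError M y n (ξ N 0 ω) := funext (hZ₀ N)
      rw [hZ]
      refine hin.condDistrib_firstSuccess hℓ ?_
      filter_upwards [hin.ae_le_one, hin.ae_proposal hpos] with ω hu hξ
      rw [hτ, CoupledPIMH.meetingTime_eq_firstSuccess_acceptProb _ _ hξ hu]
      congr 1
      ext k
      -- Both errors are relative to the likelihood `p > 0`, so that
      -- `exp (log (p' / p) - log (p₀ / p)) = p' / p₀`.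
      have hexp : Real.exp (CoupledPIMH.logError M y n (ξ N (k + 1) ω) -
          CoupledPIMH.logError M y n (ξ N 0 ω)) = (ξ N (k + 1) ω).2 / (ξ N 0 ω).2 := by
        have h1 := hξ (k + 1)
        have h0 := hξ 0
        rw [CoupledPIMH.logError, CoupledPIMH.logError, Real.exp_sub,
          Real.exp_log (div_pos h1 hp), Real.exp_log (div_pos h0 hp)]
        field_simp
      rw [CoupledPIMH.Accepts, hexp]
      rfl
  · exact CoupledPIMH.tendsto_measure_accept input hp fun ε hε =>
      CoupledPIMH.tendsto_filterLaw_deviation weightFirst_pos weightNext_pos hC0 hC1 hR hV hε
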